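/- **Soundness of the Cluster Fair Abstraction Rule (CFAR), forward and reverse.** *Terms.* Let $\mathbb E$ be a set of visible atomic events and $\tau$ the silent step. Closed terms are built from the events $e\in\mathbb E\cup\{\tau\}$, their histories $e[m]$ ($m\in\mathbb N$ a key; an executed silent step is again written $\tau$ where no confusion arises), deadlock $\delta$, the operators $+$, $\cdot$, $\parallel$, the abstraction operators $\tau_I$ ($I\subseteq\mathbb E$), and recursion constants $\langle X|E\rangle$. $Std(x)$ (resp. $NStd(x)$) means that $x$ contains only standard events (resp. only histories), and no $\delta$. A *forward linear recursive specification* $E$ has finitely many variables and one equation per variable, of the form $$X=\sum_{i}(a_{i1}\parallel\cdots\parallel a_{ik_i})\,Y_i+\sum_j (b_{j1}\parallel\cdots\parallel b_{jl_j}),$$ a *reverse* one has equations $$X=\sum_{i}Y_i\,(a_{i1}[m_i]\parallel\cdots\parallel a_{ik_i}[m_i])+\sum_j (b_{j1}[n_j]\parallel\cdots\parallel b_{jl_j}[n_j]),$$ with all $a$'s and $b$'s in $\mathbb E\cup\{\tau\}$; empty sums are $\delta$. For such $E$, $\langle X|E\rangle$ counts as $Std$ in the forward and as $NStd$ in the reverse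 case. $E$ is *guarded* if no $\langle X|E\rangle$ starts an infinite sequence of forward (resp. reverse) $\tau$-transitions. *Transitions.* Forward transitions $x\xrightarrow{U}x'$ are labelled by finite multisets $U$ of events: $e\xrightarrow{\{e\}}e[m]$ for every $m$; $x+y$ moves as $x$ or as $y$, discarding the other summand; $x\cdot y\to x'\cdot y$ if $x\to x'$, and $x\cdot y\to x\cdot y'$ if $NStd(x)$ and $y\to y'$; $x\parallel y$ moves when both components move, with the same key, with the union of the labels; $\tau_I$ renames the events of $I$ in labels to $\tau$; $\langle X|E\rangle$ moves as the right-hand side of its equation. Reverse transitions, labelled $U[m]$, are symmetric: $e[m]$ goes to $e$ with label $e[m]$, and in $x\cdot y$ the factor $y$ can always be undone, while $x$ can be undone only if $Std(y)$. Forward termination means that everything has been executed (histories are terminated; $x\cdot y$ and $x\parallel y$ are if both $x$ and $y$ are; $x+y$ is if $x$ or $y$ is; $\tau_I$ and $\langle X|E\rangle$ inherit it), and reverse termination, symmetrically, that everything has been undone. *Equivalences.* $\approx^{fr}_{rbs}$, $\approx^{fr}_{rbp}$, $\approx^{fr}_{rbhp}$ are rooted branching forward-reverse step, pomset and history-preserving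 bisimilarity. Labels are compared up to $\tau$. A branching FR step (pomset) bisimulation is a relation $R$ such that, for $(p,q)\in R$, symmetrically in $p,q$ and both for forward and for reverse transitions: if $p\to^{X}p'$, for $X$ a step (a silent step, or a run of visible steps, which are causally ordered one after the other), then either $X$ is silent and $(p',q)\in R$, or $q\to^{\tau^*}q_0$, $(p,q_0)\in R$ and $q_0\Rightarrow^{X}q'$ with $(p',q')\in R$, where $\Rightarrow^X$ allows $\tau^*$ before and after each step of $X$; and if $p$ is terminated (forward, resp. reverse), then $q\to^{\tau^*}q_0$ with $(p,q_0)\in R$ and $q_0$ terminated in the same sense. In the rooted version, a transition $p\to^X p'$ is matched by a transition $q\to^X q'$ with $p'$ and $q'$ branching FR bisimilar, where the first step of $X$ is matched by exactly one step, and terminated terms are related to terminated terms only. For hp-bisimulations, steps are used, $\Rightarrow^X$ is replaced by a single step, and the relation consists of triples $(C_1,f,C_2)$, starting with $(\emptyset,\emptyset,\emptyset)$, together with the terms reached, where $f$ is an isomorphism of labelled partial orders between the visible events performed so far (executions and undoings), which is extended at every matched step and is kept when passing from the root to the branching bisimulation. *Clusters.* Let $E$ be guarded linear and $I\subseteq\mathbb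 E$. Variables $X$ and $Y$ are in the same *cluster* for $I$ if there are finite, possibly empty, sequences of forward (for a reverse $E$: reverse) transitions, with all events in $I\cup\{\tau\}$, from $\langle X|E\rangle$ to $\langle Y|E\rangle$ and from $\langle Y|E\rangle$ to $\langle X|E\rangle$, up to the events executed (undone) on the way. A summand of the equation of a variable in the cluster $C$ is an *exit* of $C$ unless it contains a variable that lies in $C$ and all its events are in $I\cup\{\tau\}$. **Theorem.** (Forward CFAR.) If $E$ is a guarded forward linear recursive specification and $X$ is in a cluster for $I$ whose exits are exactly $(a_{i1}\parallel\cdots\parallel a_{ik_i})Y_i$ ($1\le i\le m$) and $b_{j1}\parallel\cdots\parallel b_{jl_j}$ ($1\le j\le n$), with $m,n\ge 0$, then $$\tau\cdot\tau_I(\langle X|E\rangle)\;\approx\;\tau\cdot\tau_I\Big(\sum_{i}(a_{i1}\parallel\cdots\parallel a_{ik_i})\langle Y_i|E\rangle+\sum_j b_{j1}\parallel\cdots\parallel b_{jl_j}\Big).$$ (Reverse CFAR.) If $E$ is a guarded reverse linear recursive specification and $X$ is in a cluster for $I$ whose exits are exactly $Y_i(a_{i1}[m_i]\parallel\cdots\parallel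 a_{ik_i}[m_i])$ ($1\le i\le m$) and $b_{j1}[n_j]\parallel\cdots\parallel b_{jl_j}[n_j]$ ($1\le j\le n$), with $m,n\ge 0$, then $$\tau_I(\langle X|E\rangle)\cdot\tau\;\approx\;\tau_I\Big(\sum_{i}\langle Y_i|E\rangle(a_{i1}[m_i]\parallel\cdots\parallel a_{ik_i}[m_i])+\sum_j b_{j1}[n_j]\parallel\cdots\parallel b_{jl_j}[n_j]\Big)\cdot\tau,$$ where the last $\tau$ on each side is an executed silent step. In both cases $\approx$ may be each of $\approx^{fr}_{rbs}$, $\approx^{fr}_{rbp}$ and $\approx^{fr}_{rbhp}$. An empty sum is $\delta$. -/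

import Mathlib

/-!
Reversible truly concurrent process algebra with silent step, abstraction and guarded linear
recursion: the terms built from atomic events, histories of events, deadlock, `+`, `·`, `∥`,
`τ_I` and the recursion constants `⟨X|E⟩`; their forward and reverse transitions; and the rooted
branching forward-reverse (FR) step, pomset and history-preserving bisimulations.
-/

namespace FRAlgebra

universe u v w

/-- Atomic events over a set `A` of visible events; `none` is the silent step `τ`. -/
abbrev Ev (A : Type v) := Option A

/-- A parallel composition `a₁ ∥ ⋯ ∥ aₖ` (`k ≥ 1`) of atomic events. -/
inductive Step (A : Type v) : Type v
  | ev (e : Ev A) : Step A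
  | par (s t : Step A) : Step A

/-- The multiset `{a₁, …, aₖ}` of events of `a₁ ∥ ⋯ ∥ aₖ`. -/
def Step.events {A : Type v} : Step A → Multiset (Ev A)
  | .ev e => {e}
  | .par s t => s.events + t.events

/-- A summand of a linear recursive equation: an action part and, possibly, a recursion
variable. -/
structure Summand (σ : Type v) (V : Type u) where
  act : σ
  next : Option V

/-- A forward linear recursive specification: every equation has the form
`X = (a₁₁ ∥ ⋯)Y₁ + ⋯ + (aₘ₁ ∥ ⋯)Yₘ + (b₁₁ ∥ ⋯) + ⋯ + (bₙ₁ ∥ ⋯)`.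
It sends `X` to the list of summands of its right-hand side. -/
abbrev FSpec (V : Type u) (A : Type v) := V → List (Summand (Step A) V)

/-- A reverse linear recursive specification: every equation has the form
`X = Y₁(a₁₁[m₁] ∥ ⋯) + ⋯ + Yₘ(aₘ₁[mₘ] ∥ ⋯) + (b₁₁[n₁] ∥ ⋯) + ⋯ + (bₙ₁[nₙ] ∥ ⋯)`.
The action part `(s, m)` stands for `s` with the history key `m` on each of its events. -/
abbrev RSpec (V : Type u) (A : Type v) := V → List (Summand (Step A × ℕ) V)

/-- Closed process terms. -/
inductive Term (V : Type u) (A : Type v) : Type (max u v)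
  /-- an atomic event `e` (`e = none` is `τ`) that has not been executed -/
  | act (e : Ev A) : Term V A
  /-- the history `e[m]` of the event `e` (`e = none`: an already executed `τ`) -/
  | past (e : Ev A) (m : ℕ) : Term V A
  /-- deadlock `δ` -/
  | delta : Term V A
  | alt (x y : Term V A) : Term V A
  | seq (x y : Term V A) : Term V A
  | par (x y : Term V A) : Term V A
  /-- abstraction `τ_I(x)` -/
  | abs (I : Set A) (x : Term V A) : Term V A
  /-- `⟨X|E⟩` for a forward linear specification -/
  | frec (E : FSpec V A) (X : V) : Term V A
  /-- `⟨X|E⟩` for a reverse linear specification -/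
  | rrec (E : RSpec V A) (X : V) : Term V A

variable {V : Type u} {A : Type v}

/-- `a₁ ∥ ⋯ ∥ aₖ` as a term. -/
def Step.toTerm : Step A → Term V A
  | .ev e => .act e
  | .par s t => .par s.toTerm t.toTerm

/-- `a₁[m] ∥ ⋯ ∥ aₖ[m]` as a term. -/
def Step.toPast (m : ℕ) : Step A → Term V A
  | .ev e => .past e m
  | .par s t => .par (s.toPast m) (t.toPast m)

/-- The finite sum `x₁ + ⋯ + xₙ`; the empty sum is `δ`. -/
def Term.sum : List (Term V A) → Term V A
  | [] => .delta
  | [x] => x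
  | x :: y :: l => .alt x (Term.sum (y :: l))

/-- The summand `(a₁ ∥ ⋯ ∥ aₖ)⟨Y|E⟩` or `a₁ ∥ ⋯ ∥ aₖ`. -/
def FSpec.term (E : FSpec V A) (s : Summand (Step A) V) : Term V A :=
  match s.next with
  | some Y => .seq s.act.toTerm (.frec E Y)
  | none => s.act.toTerm

/-- The summand `⟨Y|E⟩(a₁[m] ∥ ⋯ ∥ aₖ[m])` or `a₁[m] ∥ ⋯ ∥ aₖ[m]`. -/
def RSpec.term (E : RSpec V A) (s : Summand (Step A × ℕ) V) : Term V A :=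
  match s.next with
  | some Y => .seq (.rrec E Y) (s.act.1.toPast s.act.2)
  | none => s.act.1.toPast s.act.2

/-- The right-hand side of the equation of `X`, with `⟨Y|E⟩` for every variable `Y`. -/
def FSpec.rhs (E : FSpec V A) (X : V) : Term V A := Term.sum ((E X).map (FSpec.term E))

/-- The right-hand side of the equation of `X`, with `⟨Y|E⟩` for every variable `Y`. -/
def RSpec.rhs (E : RSpec V A) (X : V) : Term V A := Term.sum ((E X).map (RSpec.term E))

/-- `Std x`: `x` contains only standard events (no histories, and no deadlock). -/
def Std : Term V A → Prop
  | .act _ => True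
  | .past _ _ => False
  | .delta => False
  | .alt x y => Std x ∧ Std y
  | .seq x y => Std x ∧ Std y
  | .par x y => Std x ∧ Std y
  | .abs _ x => Std x
  | .frec _ _ => True
  | .rrec _ _ => False

/-- `NStd x`: `x` contains only histories of events (no standard events, and no deadlock). -/
def NStd : Term V A → Prop
  | .act _ => False
  | .past _ _ => True
  | .delta => False
  | .alt x y => NStd x ∧ NStd y
  | .seq x y => NStd x ∧ NStd y
  | .par x y => NStd x ∧ NStd y
  | .abs _ x => NStd x
  | .frec _ _ => False
  | .rrec _ _ => True

open Classical in
/-- The renaming of the events in `I` into `τ`. -/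
noncomputable def hide (I : Set A) : Ev A → Ev A
  | none => none
  | some a => if a ∈ I then none else some a

/-- `Fwd m U x y`: the forward transition `x —U→ y`, where the executed events get the key `m`.
The rule `seqR` lets the second factor of `x · y` proceed once the first one has been executed;
`Fwd.par` covers all cases for `∥`, as without communication the whole parallel operator is `∥`. -/
inductive Fwd : ℕ → Multiset (Ev A) → Term V A → Term V A → Prop
  | act (e : Ev A) (m : ℕ) : Fwd m {e} (.act e) (.past e m)
  | altL {m U x x'} (y) : Fwd m U x x' → Fwd m U (.alt x y) x'
  | altR {m U y y'} (x) : Fwd m U y y' → Fwd m U (.alt x y) y'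
  | seqL {m U x x'} (y) : Fwd m U x x' → Fwd m U (.seq x y) (.seq x' y)
  | seqR {m U x y y'} : NStd x → Fwd m U y y' → Fwd m U (.seq x y) (.seq x y')
  | par {m U W x x' y y'} :
      Fwd m U x x' → Fwd m W y y' → Fwd m (U + W) (.par x y) (.par x' y')
  | abs {m U x x'} (I : Set A) :
      Fwd m U x x' → Fwd m (U.map (hide I)) (.abs I x) (.abs I x')
  | frec {m U y} (E : FSpec V A) (X : V) : Fwd m U (E.rhs X) y → Fwd m U (.frec E X) y
  | rrec {m U y} (E : RSpec V A) (X : V) : Fwd m U (E.rhs X) y → Fwd m U (.rrec E X) y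

/-- `Rev m U x y`: the reverse transition from `x` to `y` labelled `U[m]`, which undoes the
events of `U` with key `m`. The rule `seqL` lets the first factor of `x · y` be undone once the
second one is entirely standard. -/
inductive Rev : ℕ → Multiset (Ev A) → Term V A → Term V A → Prop
  | past (e : Ev A) (m : ℕ) : Rev m {e} (.past e m) (.act e)
  | altL {m U x x'} (y) : Rev m U x x' → Rev m U (.alt x y) x'
  | altR {m U y y'} (x) : Rev m U y y' → Rev m U (.alt x y) y'
  | seqR {m U y y'} (x) : Rev m U y y' → Rev m U (.seq x y) (.seq x y')
  | seqL {m U x x' y} : Std y → Rev m U x x' → Rev m U (.seq x y) (.seq x' y)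
  | par {m U W x x' y y'} :
      Rev m U x x' → Rev m W y y' → Rev m (U + W) (.par x y) (.par x' y')
  | abs {m U x x'} (I : Set A) :
      Rev m U x x' → Rev m (U.map (hide I)) (.abs I x) (.abs I x')
  | frec {m U y} (E : FSpec V A) (X : V) : Rev m U (E.rhs X) y → Rev m U (.frec E X) y
  | rrec {m U y} (E : RSpec V A) (X : V) : Rev m U (E.rhs X) y → Rev m U (.rrec E X) y

/-- Successful forward termination: everything has been executed. -/
inductive FTerm : Term V A → Prop
  | past (e m) : FTerm (.past e m)
  | altL {x} (y) : FTerm x → FTerm (.alt x y)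
  | altR {y} (x) : FTerm y → FTerm (.alt x y)
  | seq {x y} : FTerm x → FTerm y → FTerm (.seq x y)
  | par {x y} : FTerm x → FTerm y → FTerm (.par x y)
  | abs {x} (I) : FTerm x → FTerm (.abs I x)
  | frec (E : FSpec V A) (X) : FTerm (E.rhs X) → FTerm (.frec E X)
  | rrec (E : RSpec V A) (X) : FTerm (E.rhs X) → FTerm (.rrec E X)

/-- Successful reverse termination: everything has been undone. -/
inductive RTerm : Term V A → Prop
  | act (e) : RTerm (.act e)
  | altL {x} (y) : RTerm x → RTerm (.alt x y)
  | altR {y} (x) : RTerm y → RTerm (.alt x y)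
  | seq {x y} : RTerm x → RTerm y → RTerm (.seq x y)
  | par {x y} : RTerm x → RTerm y → RTerm (.par x y)
  | abs {x} (I) : RTerm x → RTerm (.abs I x)
  | frec (E : FSpec V A) (X) : RTerm (E.rhs X) → RTerm (.frec E X)
  | rrec (E : RSpec V A) (X) : RTerm (E.rhs X) → RTerm (.rrec E X)

/-- The visible part of a step. -/
def vis (U : Multiset (Ev A)) : Multiset A := U.filterMap id

/-- Forward steps, labelled by their visible part; the label `0` is a silent step. -/
def fstep (S : Multiset A) (x y : Term V A) : Prop := ∃ m U, Fwd m U x y ∧ vis U = S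

/-- Reverse steps, labelled by their visible part with keys; the label `0` is a silent step. -/
def rstep (S : Multiset (A × ℕ)) (x y : Term V A) : Prop :=
  ∃ m U, Rev m U x y ∧ (vis U).map (fun a => (a, m)) = S

section Bisimulation

variable {P : Type w} {β : Type v}

/-- `—τ*→` -/
abbrev TauStar (T : Multiset β → P → P → Prop) : P → P → Prop := Relation.ReflTransGen (T 0)

/-- Consecutive steps with labels `S₁, …, Sₖ`. In this algebra all events of a later step of a
run causally depend on all events of the earlier ones, so that `[S₁, …, Sₖ]` represents the
pomset in which the events of each `Sᵢ` are pairwise concurrent and precede those of `Sᵢ₊₁`. -/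
def Run (T : Multiset β → P → P → Prop) : List (Multiset β) → P → P → Prop
  | [], x, y => x = y
  | S :: L, x, y => ∃ z, T S x z ∧ Run T L z y

/-- Weak transitions: `—τ*→ —S→ —τ*→` for every `S` of the list, in order. -/
def WRun (T : Multiset β → P → P → Prop) : List (Multiset β) → P → P → Prop
  | [], x, y => x = y
  | S :: L, x, y => ∃ x₁ x₂ x₃, TauStar T x x₁ ∧ T S x₁ x₂ ∧ TauStar T x₂ x₃ ∧ WRun T L x₃ y

/-- A class of transition labels, used for forward and for reverse transitions alike. -/
abbrev LabelClass := ∀ {β : Type v}, List (Multiset β) → Prop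

/-- The labels of step transitions. -/
def IsStep : LabelClass.{v} := fun L => ∃ S, L = [S]

/-- The labels of pomset transitions: a silent step, or a nonempty pomset of visible events. -/
def IsPomset : LabelClass.{v} := fun L => L = [0] ∨ (L ≠ [] ∧ 0 ∉ L)

/-- The transfer conditions of a branching bisimulation from left to right, for the transition
relation `T`, the labels in `𝓛` and the termination predicate `D`. -/
def BranchingTransfer (𝓛 : List (Multiset β) → Prop) (T : Multiset β → P → P → Prop)
    (D : P → Prop) (R : P → P → Prop) : Prop :=
  ∀ p q, R p q →
    (∀ L p', 𝓛 L → Run T L p p' →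
      (L = [0] ∧ R p' q) ∨
      ∃ q₀ q', TauStar T q q₀ ∧ R p q₀ ∧ WRun T L q₀ q' ∧ R p' q') ∧
    (D p → ∃ q₀, TauStar T q q₀ ∧ R p q₀ ∧ D q₀)

/-- Transitions at the root: the first step is matched by a single step, silent events being
allowed only around the later steps of a pomset. -/
def RootRun (T : Multiset β → P → P → Prop) : List (Multiset β) → P → P → Prop
  | [], x, y => x = y
  | S :: L, x, y => ∃ z, T S x z ∧ WRun T L z y

/-- The transfer conditions of a rooted branching bisimulation from left to right; `B` is the
branching bisimilarity that is required after the transition. -/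
def RootedTransfer (𝓛 : List (Multiset β) → Prop) (T : Multiset β → P → P → Prop)
    (D : P → Prop) (B : P → P → Prop) (R : P → P → Prop) : Prop :=
  ∀ p q, R p q →
    (∀ L p', 𝓛 L → Run T L p p' → ∃ q', RootRun T L q q' ∧ B p' q') ∧ (D p → D q)

end Bisimulation

/-- `R` is a branching FR (step or pomset) bisimulation. -/
def IsBranchingFR (𝓛 : LabelClass.{v}) (R : Term V A → Term V A → Prop) : Prop :=
  BranchingTransfer 𝓛 fstep FTerm R ∧ BranchingTransfer 𝓛 fstep FTerm (flip R) ∧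
  BranchingTransfer 𝓛 rstep RTerm R ∧ BranchingTransfer 𝓛 rstep RTerm (flip R)

/-- Branching FR (step or pomset) bisimilarity. -/
def BranchingFR (𝓛 : LabelClass.{v}) (p q : Term V A) : Prop :=
  ∃ R : Term V A → Term V A → Prop, IsBranchingFR 𝓛 R ∧ R p q

/-- `R` is a rooted branching FR (step or pomset) bisimulation. -/
def IsRootedBranchingFR (𝓛 : LabelClass.{v}) (R : Term V A → Term V A → Prop) : Prop :=
  RootedTransfer 𝓛 fstep FTerm (BranchingFR 𝓛) R ∧
  RootedTransfer 𝓛 fstep FTerm (flip (BranchingFR 𝓛)) (flip R) ∧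
  RootedTransfer 𝓛 rstep RTerm (BranchingFR 𝓛) R ∧
  RootedTransfer 𝓛 rstep RTerm (flip (BranchingFR 𝓛)) (flip R)

/-- Rooted branching FR step bisimilarity `≈_rbs^fr`. -/
def RbsFR (p q : Term V A) : Prop :=
  ∃ R : Term V A → Term V A → Prop, IsRootedBranchingFR IsStep R ∧ R p q

/-- Rooted branching FR pomset bisimilarity `≈_rbp^fr`. -/
def RbpFR (p q : Term V A) : Prop :=
  ∃ R : Term V A → Term V A → Prop, IsRootedBranchingFR IsPomset R ∧ R p q

section HistoryPreserving

/-- The visible events of a configuration: `inl a` is an execution of `a`, `inr a` an undone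
history of `a`. -/
abbrev Obs (A : Type v) := A ⊕ A

/-- The visible part of a configuration reached by a run: the list of the steps performed. Events
of one step are concurrent, and an event of an earlier step precedes one of a later step. -/
abbrev Config (A : Type v) := List (Multiset (Obs A))

/-- An event occurrence: the number of its step, its label, and a number that distinguishes equal
labels in one step. -/
structure Occ (A : Type v) where
  level : ℕ
  label : Obs A
  index : ℕ

open Classical in
/-- The event occurrences of a configuration. -/
def Config.occs (C : Config A) : Set (Occ A) :=
  {e | ∃ S, C[e.level]? = some S ∧ e.index < S.count e.label}

open Classical in
/-- `C` followed by a further step; a silent step adds no visible event. -/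
noncomputable def Config.extend (C : Config A) (S : Multiset (Obs A)) : Config A :=
  if S = 0 then C else C ++ [S]

/-- `(C₁, f, C₂)` is in the weakly posetal product: `f` restricts to an isomorphism of labelled
partial orders between the visible events of `C₁` and those of `C₂`. -/
def IsPosetal (C₁ : Config A) (f : Occ A → Occ A) (C₂ : Config A) : Prop :=
  Set.BijOn f C₁.occs C₂.occs ∧
  (∀ e ∈ C₁.occs, (f e).label = e.label) ∧
  ∀ e ∈ C₁.occs, ∀ e' ∈ C₁.occs, (f e).level < (f e').level ↔ e.level < e'.level

/-- Relations between triples `(C₁, f, C₂)`, together with the terms reached. -/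
abbrev PosetalRel (V : Type u) (A : Type v) :=
  Config A → (Occ A → Occ A) → Config A → Term V A → Term V A → Prop

variable {β : Type v}

/-- The transfer conditions, in both directions, of a branching hp-bisimulation for the transition
relation `T`, whose labels are recorded in configurations by `g`, and the termination predicate
`D`. -/
def HPTransfer (T : Multiset β → Term V A → Term V A → Prop) (g : β → Obs A)
    (D : Term V A → Prop) (R : PosetalRel V A) : Prop :=
  ∀ C₁ f C₂ p q, R C₁ f C₂ p q →
    (∀ S₁ p', T S₁ p p' →
      (S₁ = 0 ∧ R C₁ f C₂ p' q) ∨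
      ∃ q₀ q' S₂ f', TauStar T q q₀ ∧ R C₁ f C₂ p q₀ ∧ T S₂ q₀ q' ∧ Set.EqOn f' f C₁.occs ∧
        R (C₁.extend (S₁.map g)) f' (C₂.extend (S₂.map g)) p' q') ∧
    (∀ S₂ q', T S₂ q q' →
      (S₂ = 0 ∧ R C₁ f C₂ p q') ∨
      ∃ p₀ p' S₁ f', TauStar T p p₀ ∧ R C₁ f C₂ p₀ q ∧ T S₁ p₀ p' ∧ Set.EqOn f' f C₁.occs ∧
        R (C₁.extend (S₁.map g)) f' (C₂.extend (S₂.map g)) p' q') ∧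
    (D p → ∃ q₀, TauStar T q q₀ ∧ R C₁ f C₂ p q₀ ∧ D q₀) ∧
    (D q → ∃ p₀, TauStar T p p₀ ∧ R C₁ f C₂ p₀ q ∧ D p₀)

/-- `R` is a branching FR hp-bisimulation. -/
def IsBranchingHP (R : PosetalRel V A) : Prop :=
  (∀ C₁ f C₂ p q, R C₁ f C₂ p q → IsPosetal C₁ f C₂) ∧
  HPTransfer fstep Sum.inl FTerm R ∧ HPTransfer rstep (fun x => Sum.inr x.1) RTerm R

/-- Branching FR hp-bisimilarity, as the largest branching FR hp-bisimulation. -/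
def BranchingHP : PosetalRel V A := fun C₁ f C₂ p q =>
  ∃ R : PosetalRel V A, IsBranchingHP R ∧ R C₁ f C₂ p q

/-- The transfer conditions, in both directions, of a rooted branching FR hp-bisimulation. -/
def RootedHPTransfer (T : Multiset β → Term V A → Term V A → Prop) (g : β → Obs A)
    (D : Term V A → Prop) (R : PosetalRel V A) : Prop :=
  ∀ C₁ f C₂ p q, R C₁ f C₂ p q →
    (∀ S₁ p', T S₁ p p' → ∃ q' S₂ f', T S₂ q q' ∧ Set.EqOn f' f C₁.occs ∧
      BranchingHP (C₁.extend (S₁.map g)) f' (C₂.extend (S₂.map g)) p' q') ∧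
    (∀ S₂ q', T S₂ q q' → ∃ p' S₁ f', T S₁ p p' ∧ Set.EqOn f' f C₁.occs ∧
      BranchingHP (C₁.extend (S₁.map g)) f' (C₂.extend (S₂.map g)) p' q') ∧
    (D p ↔ D q)

/-- `R` is a rooted branching FR hp-bisimulation. -/
def IsRootedBranchingHP (R : PosetalRel V A) : Prop :=
  (∀ C₁ f C₂ p q, R C₁ f C₂ p q → IsPosetal C₁ f C₂) ∧
  RootedHPTransfer fstep Sum.inl FTerm R ∧
  RootedHPTransfer rstep (fun x => Sum.inr x.1) RTerm R

/-- Rooted branching FR hp-bisimilarity `≈_rbhp^fr`: some rooted branching FR hp-bisimulation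
contains the triple of empty configurations. -/
def RbhpFR (p q : Term V A) : Prop :=
  ∃ R : PosetalRel V A, IsRootedBranchingHP R ∧ R [] id [] p q

end HistoryPreserving

section Clusters

/-- All events of `U` are in `I ∪ {τ}`. -/
def Internal (I : Set A) (U : Multiset (Ev A)) : Prop := ∀ a : A, some a ∈ U → a ∈ I

/-- A forward specification is guarded if no `⟨X|E⟩` starts an infinite sequence of
`τ`-transitions. -/
def FSpec.Guarded (E : FSpec V A) : Prop :=
  ¬ ∃ t : ℕ → Term V A, (∃ X, t 0 = .frec E X) ∧ ∀ n, fstep 0 (t n) (t (n + 1))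

/-- A reverse specification is guarded if no `⟨X|E⟩` starts an infinite sequence of reverse
`τ`-transitions. -/
def RSpec.Guarded (E : RSpec V A) : Prop :=
  ¬ ∃ t : ℕ → Term V A, (∃ X, t 0 = .rrec E X) ∧ ∀ n, rstep 0 (t n) (t (n + 1))

/-- The term is `⟨Y|E⟩`, up to the history of the events that were executed before. -/
inductive FSpec.At (E : FSpec V A) (Y : V) : Term V A → Prop
  | here : FSpec.At E Y (.frec E Y)
  | after {h t} : NStd h → FSpec.At E Y t → FSpec.At E Y (.seq h t)

/-- The term is `⟨Y|E⟩`, up to the events that were undone before. -/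
inductive RSpec.At (E : RSpec V A) (Y : V) : Term V A → Prop
  | here : RSpec.At E Y (.rrec E Y)
  | before {t h} : Std h → RSpec.At E Y t → RSpec.At E Y (.seq t h)

/-- Forward transitions with events in `I ∪ {τ}` lead from `⟨X|E⟩` to `⟨Y|E⟩`. -/
def FSpec.Reaches (E : FSpec V A) (I : Set A) (X Y : V) : Prop :=
  ∃ t, Relation.ReflTransGen (fun x y => ∃ m U, Fwd m U x y ∧ Internal I U) (.frec E X) t ∧
    FSpec.At E Y t

/-- Reverse transitions with events in `I ∪ {τ}` lead from `⟨X|E⟩` to `⟨Y|E⟩`. -/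
def RSpec.Reaches (E : RSpec V A) (I : Set A) (X Y : V) : Prop :=
  ∃ t, Relation.ReflTransGen (fun x y => ∃ m U, Rev m U x y ∧ Internal I U) (.rrec E X) t ∧
    RSpec.At E Y t

/-- `X` and `Y` are in the same cluster for `I`. -/
def FSpec.SameCluster (E : FSpec V A) (I : Set A) (X Y : V) : Prop :=
  FSpec.Reaches E I X Y ∧ FSpec.Reaches E I Y X

/-- `X` and `Y` are in the same cluster for `I`. -/
def RSpec.SameCluster (E : RSpec V A) (I : Set A) (X Y : V) : Prop :=
  RSpec.Reaches E I X Y ∧ RSpec.Reaches E I Y X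

/-- `s` is an exit of the cluster of `X` for `I`. -/
def FSpec.IsExit (E : FSpec V A) (I : Set A) (X : V) (s : Summand (Step A) V) : Prop :=
  (∃ Y, FSpec.SameCluster E I X Y ∧ s ∈ E Y) ∧
  ∀ Z, s.next = some Z → ¬ Internal I s.act.events ∨ ¬ FSpec.SameCluster E I X Z

/-- `s` is an exit of the cluster of `X` for `I`. -/
def RSpec.IsExit (E : RSpec V A) (I : Set A) (X : V) (s : Summand (Step A × ℕ) V) : Prop :=
  (∃ Y, RSpec.SameCluster E I X Y ∧ s ∈ E Y) ∧
  ∀ Z, s.next = some Z → ¬ Internal I s.act.1.events ∨ ¬ RSpec.SameCluster E I X Z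

end Clusters

end FRAlgebra

/-! The abstraction rule is proved by exhibiting one symmetric relation, `CfarRel`, that serves all
three equivalences. Every move outside the relation's silent absorptions is answered by silent steps
followed by one step with the same visible label and key. Such an answer lifts to steps, to pomsets
(step by step along a run) and to hp-bisimulation (with equal configurations and the identity as
isomorphism). This is `Matches.rooted`.

The forward and reverse rules are one statement, because exchanging execution with undoing exchanges
the two factors of `·`. A Boolean `d` selects the direction in which the specification is to run,
and `!d` is the opposite one. `LinearSystem` records what the two kinds of specification share.

A state has the form `o · τ_I(u)` (mirrored for `d = false`), where `o` is a silent step and `u` is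
a core term preceded by internal steps. A pair in `CfarRel` is of one of two kinds. Before an exit,
each core is a cluster variable or the sum of exits, and the prefixes may be in any stage of
execution. An internal move inside the cluster is silent and is absorbed. To answer an exit, the
other side completes its prefix and travels inside the cluster to the variable that owns the exit,
all silently and without leaving the relation; this is `IsCluster.keyedTransfer`. Moves in direction
`!d` can only touch the prefix, so they are silent. After an exit, both sides have the same core
behind different prefixes (`Good`). Moves of the core are copied. A prefix can be undone only when
nothing in the core is left to undo, so these silent moves are again absorbed.

The delicate point is termination in direction `!d`. It passes through the recursion and holds for a
constant exactly when some chain of summands ends in one without a variable (`Ends`). This property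
is shared by all variables of a cluster and by its sum of exits (`IsCluster.tail_fin`). -/

namespace FRAlgebra

universe u v w

variable {V : Type u} {A : Type v}

/-! ### Reduction of the three equivalences to matching single steps -/

section Matching

variable {P : Type w} {β : Type v}

/-- Every transition of `p` is absorbed or matched by one transition with the same label after
silent steps that stay related to `p`, and so is termination. -/
def StepTransfer (T : Multiset β → P → P → Prop) (D : P → Prop) (R : P → P → Prop) : Prop :=
  ∀ p q, R p q →
    (∀ S p', T S p p' → (S = 0 ∧ R p' q) ∨
      ∃ q₀ q', TauStar T q q₀ ∧ R p q₀ ∧ T S q₀ q' ∧ R p' q') ∧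
    (D p → ∃ q₀, TauStar T q q₀ ∧ R p q₀ ∧ D q₀)

/-- Every transition of `p` is matched by one transition of `q` with the same label. -/
def RootStep (T : Multiset β → P → P → Prop) (D : P → Prop) (R : P → P → Prop) (p q : P) : Prop :=
  (∀ S p', T S p p' → ∃ q', T S q q' ∧ R p' q') ∧ (D p → D q)

/-- Absorption applies to silent steps only, so in a run of visible steps each one receives a
genuine answer, and the answers concatenate. -/
theorem StepTransfer.wrun {T : Multiset β → P → P → Prop} {D : P → Prop} {R : P → P → Prop}
    (h : StepTransfer T D R) {L : List (Multiset β)} (hL : 0 ∉ L) {p q p' : P} (hpq : R p q)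
    (hr : Run T L p p') : ∃ q', WRun T L q q' ∧ R p' q' := by
  induction L generalizing p q with
  | nil => cases hr; exact ⟨q, rfl, hpq⟩
  | cons S L ih =>
    obtain ⟨z, hz, hr⟩ := hr
    rcases (h p q hpq).1 S z hz with ⟨rfl, -⟩ | ⟨q₀, q₁, h0, -, h1, h2⟩
    · simp at hL
    · obtain ⟨q', hw, hR⟩ := ih (fun h => hL (List.mem_cons_of_mem _ h)) h2 hr
      exact ⟨q', ⟨q₀, q₁, q₁, h0, h1, .refl, hw⟩, hR⟩

/-- Nonempty runs in which silent steps occur only alone. -/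
def Admissible (𝓛 : List (Multiset β) → Prop) : Prop :=
  ∀ L, 𝓛 L → ∃ S L', L = S :: L' ∧ 0 ∉ L' ∧ (S = 0 → L' = [])

theorem admissible_isStep : Admissible (IsStep (β := β)) := by
  rintro _ ⟨S, rfl⟩
  exact ⟨S, [], rfl, by simp, fun _ => rfl⟩

theorem admissible_isPomset : Admissible (IsPomset (β := β)) := by
  rintro L (rfl | ⟨h1, h2⟩)
  · exact ⟨0, [], rfl, by simp, fun _ => rfl⟩
  · obtain ⟨S, L', rfl⟩ := List.exists_cons_of_ne_nil h1
    simp only [List.mem_cons, not_or] at h2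
    exact ⟨S, L', rfl, h2.2, fun h => absurd h.symm h2.1⟩

theorem StepTransfer.branchingTransfer {T : Multiset β → P → P → Prop} {D : P → Prop}
    {R : P → P → Prop} (h : StepTransfer T D R) {𝓛 : List (Multiset β) → Prop}
    (h𝓛 : Admissible 𝓛) : BranchingTransfer 𝓛 T D R := by
  intro p q hpq
  refine ⟨fun L p' hL hr => ?_, (h p q hpq).2⟩
  obtain ⟨S, L', rfl, h0, hS⟩ := h𝓛 L hL
  obtain ⟨z, hz, hr⟩ := hr
  rcases (h p q hpq).1 S z hz with ⟨rfl, hR⟩ | ⟨q₀, q₁, h1, h2, h3, h4⟩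
  -- An absorbed first step is silent, and admissibility then makes it the whole label, as the
  -- stuttering clause requires.
  · obtain rfl := hS rfl
    cases hr
    exact .inl ⟨rfl, hR⟩
  · obtain ⟨q', hw, hR⟩ := h.wrun h0 h4 hr
    exact .inr ⟨q₀, q', h1, h2, ⟨q₀, q₁, q₁, .refl, h3, .refl, hw⟩, hR⟩

theorem StepTransfer.rootedTransfer {T : Multiset β → P → P → Prop} {D : P → Prop}
    {R B : P → P → Prop} (h : StepTransfer T D R) (hB : ∀ p q, R p q → B p q)
    {𝓛 : List (Multiset β) → Prop} (h𝓛 : Admissible 𝓛) {R₀ : P → P → Prop}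
    (h0 : ∀ p q, R₀ p q → RootStep T D R p q) : RootedTransfer 𝓛 T D B R₀ := by
  intro p q hpq
  refine ⟨fun L p' hL hr => ?_, (h0 p q hpq).2⟩
  obtain ⟨S, L', rfl, hL', -⟩ := h𝓛 L hL
  obtain ⟨z, hz, hr⟩ := hr
  obtain ⟨q₁, h1, h2⟩ := (h0 p q hpq).1 S z hz
  obtain ⟨q', hw, hR⟩ := h.wrun hL' h2 hr
  exact ⟨q', ⟨q₁, h1, hw⟩, hB _ _ hR⟩

end Matching

/-- Related terms match each other's forward and reverse steps. -/
structure Matches (R : Term V A → Term V A → Prop) : Prop where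
  symm : ∀ p q, R p q → R q p
  fwd : StepTransfer fstep FTerm R
  rev : StepTransfer rstep RTerm R

/-- Symmetry lets one transfer check per direction of time cover both sides of the bisimulation. -/
theorem Matches.flip_eq {R : Term V A → Term V A → Prop} (h : Matches R) : flip R = R := by
  funext p q
  exact propext ⟨h.symm q p, h.symm p q⟩

theorem Matches.branchingFR {R : Term V A → Term V A → Prop} (h : Matches R)
    {𝓛 : LabelClass.{v}} (h𝓛 : ∀ β : Type v, Admissible (𝓛 (β := β))) {p q : Term V A}
    (hpq : R p q) : BranchingFR 𝓛 p q := by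
  refine ⟨R, ⟨h.fwd.branchingTransfer (h𝓛 _), ?_, h.rev.branchingTransfer (h𝓛 _), ?_⟩, hpq⟩
  · rw [h.flip_eq]; exact h.fwd.branchingTransfer (h𝓛 _)
  · rw [h.flip_eq]; exact h.rev.branchingTransfer (h𝓛 _)

/-- The transitions of `p` and `q` lead to related terms. -/
structure RootMatches (R : Term V A → Term V A → Prop) (p q : Term V A) : Prop where
  fwd : RootStep fstep FTerm R p q
  rev : RootStep rstep RTerm R p q

theorem Matches.isRootedBranchingFR {R : Term V A → Term V A → Prop} (h : Matches R)
    {𝓛 : LabelClass.{v}} (h𝓛 : ∀ β : Type v, Admissible (𝓛 (β := β))) {p q : Term V A}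
    (hpq : RootMatches R p q) (hqp : RootMatches R q p) :
    IsRootedBranchingFR 𝓛 (fun x y => x = p ∧ y = q) := by
  have hB : ∀ x y, R x y → BranchingFR 𝓛 x y := fun x y hxy => h.branchingFR h𝓛 hxy
  have hB' : ∀ x y, R x y → flip (BranchingFR 𝓛) x y := fun x y hxy => hB _ _ (h.symm _ _ hxy)
  refine ⟨h.fwd.rootedTransfer hB (h𝓛 _) ?_, h.fwd.rootedTransfer hB' (h𝓛 _) ?_,
    h.rev.rootedTransfer hB (h𝓛 _) ?_, h.rev.rootedTransfer hB' (h𝓛 _) ?_⟩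
  · rintro x y ⟨rfl, rfl⟩; exact hpq.fwd
  · rintro x y ⟨rfl, rfl⟩; exact hqp.fwd
  · rintro x y ⟨rfl, rfl⟩; exact hpq.rev
  · rintro x y ⟨rfl, rfl⟩; exact hqp.rev

/-- `R` on the diagonal of the weakly posetal product. -/
def diagonalRel (R : Term V A → Term V A → Prop) : PosetalRel V A :=
  fun C₁ f C₂ p q => C₁ = C₂ ∧ f = id ∧ R p q

theorem diagonalRel.isPosetal {R : Term V A → Term V A → Prop} {C₁ f C₂ p q}
    (h : diagonalRel R C₁ f C₂ p q) : IsPosetal C₁ f C₂ := by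
  obtain ⟨rfl, rfl, -⟩ := h
  exact ⟨Set.bijOn_id _, fun _ _ => rfl, fun _ _ _ _ => Iff.rfl⟩

/-- Matched steps carry equal labels, so both configurations grow in the same way and the identity
remains the isomorphism. -/
theorem StepTransfer.hpTransfer {β : Type v} {T : Multiset β → Term V A → Term V A → Prop}
    {D : Term V A → Prop} {R : Term V A → Term V A → Prop} (hs : ∀ p q, R p q → R q p)
    (h : StepTransfer T D R) (g : β → Obs A) : HPTransfer T g D (diagonalRel R) := by
  rintro C f _ p q ⟨rfl, rfl, hpq⟩
  refine ⟨fun S p' hp => ?_, fun S q' hq => ?_, fun hp => ?_, fun hq => ?_⟩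
  · rcases (h p q hpq).1 S p' hp with ⟨hS, hR⟩ | ⟨q₀, q', h1, h2, h3, h4⟩
    · exact .inl ⟨hS, rfl, rfl, hR⟩
    · exact .inr ⟨q₀, q', S, id, h1, ⟨rfl, rfl, h2⟩, h3, fun _ _ => rfl, rfl, rfl, h4⟩
  · rcases (h q p (hs _ _ hpq)).1 S q' hq with ⟨hS, hR⟩ | ⟨p₀, p', h1, h2, h3, h4⟩
    · exact .inl ⟨hS, rfl, rfl, hs _ _ hR⟩
    · exact .inr ⟨p₀, p', S, id, h1, ⟨rfl, rfl, hs _ _ h2⟩, h3, fun _ _ => rfl, rfl, rfl,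
        hs _ _ h4⟩
  · obtain ⟨q₀, h1, h2, h3⟩ := (h p q hpq).2 hp
    exact ⟨q₀, h1, ⟨rfl, rfl, h2⟩, h3⟩
  · obtain ⟨p₀, h1, h2, h3⟩ := (h q p (hs _ _ hpq)).2 hq
    exact ⟨p₀, h1, ⟨rfl, rfl, hs _ _ h2⟩, h3⟩

theorem Matches.branchingHP {R : Term V A → Term V A → Prop} (h : Matches R) {C p q}
    (hpq : R p q) : BranchingHP C id C p q :=
  ⟨diagonalRel R, ⟨fun _ _ _ _ _ h' => h'.isPosetal, h.fwd.hpTransfer h.symm _,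
    h.rev.hpTransfer h.symm _⟩, rfl, rfl, hpq⟩

theorem Matches.rootedHPTransfer {R : Term V A → Term V A → Prop} (h : Matches R) {β : Type v}
    {T : Multiset β → Term V A → Term V A → Prop} {D : Term V A → Prop} {p q : Term V A}
    (hpq : RootStep T D R p q) (hqp : RootStep T D R q p) (g : β → Obs A) :
    RootedHPTransfer T g D (diagonalRel fun x y => x = p ∧ y = q) := by
  rintro C f _ _ _ ⟨rfl, rfl, rfl, rfl⟩
  refine ⟨fun S p' hp => ?_, fun S q' hq => ?_, hpq.2, hqp.2⟩
  · obtain ⟨q', h1, h2⟩ := hpq.1 S p' hp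
    exact ⟨q', S, id, h1, fun _ _ => rfl, h.branchingHP h2⟩
  · obtain ⟨p', h1, h2⟩ := hqp.1 S q' hq
    exact ⟨p', S, id, h1, fun _ _ => rfl, h.branchingHP (h.symm _ _ h2)⟩

theorem Matches.rooted {R : Term V A → Term V A → Prop} (h : Matches R) {p q : Term V A}
    (hpq : RootMatches R p q) (hqp : RootMatches R q p) :
    RbsFR p q ∧ RbpFR p q ∧ RbhpFR p q :=
  ⟨⟨_, h.isRootedBranchingFR (fun _ => admissible_isStep) hpq hqp, rfl, rfl⟩,
    ⟨_, h.isRootedBranchingFR (fun _ => admissible_isPomset) hpq hqp, rfl, rfl⟩,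
    ⟨_, ⟨fun _ _ _ _ _ h' => h'.isPosetal, h.rootedHPTransfer hpq.fwd hqp.fwd _,
      h.rootedHPTransfer hpq.rev hqp.rev _⟩, rfl, rfl, rfl, rfl⟩⟩

/-! ### Direction-independent calculus of transitions and termination -/

/-- Forward (`true`) or reverse (`false`) transitions. -/
def mv : Bool → ℕ → Multiset (Ev A) → Term V A → Term V A → Prop
  | true => Fwd
  | false => Rev

/-- Forward or reverse termination. -/
def fin : Bool → Term V A → Prop
  | true => FTerm
  | false => RTerm

/-- Terms on which nothing has been done in the given direction. -/
def base : Bool → Term V A → Prop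
  | true => Std
  | false => NStd

/-- The sequential composition in which `h` comes before `x` in the given direction. -/
def sq : Bool → Term V A → Term V A → Term V A
  | true, h, x => .seq h x
  | false, h, x => .seq x h

/-- A step that is to be done in the given direction. -/
def todo : Bool → Step A → ℕ → Term V A
  | true, s, _ => s.toTerm
  | false, s, k => s.toPast k

/-- Terms built from parts that cannot move in the given direction. -/
def Inert : Bool → Term V A → Prop
  | d, .act _ => d = false
  | d, .past _ _ => d = true
  | _, .delta => True
  | d, .alt x y => Inert d x ∧ Inert d y
  | d, .seq x y => Inert d x ∧ Inert d y
  | d, .par x y => Inert d x ∧ Inert d y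
  | d, .abs _ x => Inert d x
  | d, .frec _ _ => d = false
  | d, .rrec _ _ => d = true

section Sum

theorem mv_sum {d : Bool} {m U} {l : List (Term V A)} {y : Term V A} :
    mv d m U (.sum l) y ↔ ∃ x ∈ l, mv d m U x y := by
  induction l with
  | nil => cases d <;> simp only [Term.sum, List.not_mem_nil, false_and, exists_false, iff_false] <;>
      exact fun h => nomatch h
  | cons x l ih =>
    cases l with
    | nil => simp [Term.sum]
    | cons x' l =>
      rw [List.exists_mem_cons_iff, ← ih, Term.sum]
      cases d <;> constructor
      · rintro (_ | _ | _); exacts [.inl ‹_›, .inr ‹_›]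
      · rintro (h | h); exacts [.altL _ h, .altR _ h]
      · rintro (_ | _ | _); exacts [.inl ‹_›, .inr ‹_›]
      · rintro (h | h); exacts [.altL _ h, .altR _ h]

theorem fin_sum {d : Bool} {l : List (Term V A)} : fin d (.sum l) ↔ ∃ x ∈ l, fin d x := by
  induction l with
  | nil => cases d <;> simp only [Term.sum, List.not_mem_nil, false_and, exists_false, iff_false] <;>
      exact fun h => nomatch h
  | cons x l ih =>
    cases l with
    | nil => simp [Term.sum]
    | cons x' l =>
      rw [List.exists_mem_cons_iff, ← ih, Term.sum]
      cases d <;> constructor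
      · rintro (_ | _ | _); exacts [.inl ‹_›, .inr ‹_›]
      · rintro (h | h); exacts [.altL _ h, .altR _ h]
      · rintro (_ | _ | _); exacts [.inl ‹_›, .inr ‹_›]
      · rintro (h | h); exacts [.altL _ h, .altR _ h]

theorem inert_sum {d : Bool} {l : List (Term V A)} : Inert d (.sum l) ↔ ∀ x ∈ l, Inert d x := by
  induction l with
  | nil => simp [Term.sum, Inert]
  | cons x l ih =>
    cases l with
    | nil => simp [Term.sum]
    | cons x' l => rw [List.forall_mem_cons, ← ih, Term.sum, Inert]

theorem base_sum {d : Bool} {l : List (Term V A)} (hl : l ≠ []) (h : ∀ x ∈ l, base d x) :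
    base d (.sum l) := by
  induction l with
  | nil => exact absurd rfl hl
  | cons x l ih =>
    rw [List.forall_mem_cons] at h
    cases l with
    | nil => exact h.1
    | cons x' l => cases d <;> exact ⟨h.1, ih (by simp) h.2⟩

end Sum

section Basic

variable {d : Bool} {m : ℕ} {U : Multiset (Ev A)}

theorem mv_sq {h x y : Term V A} : mv d m U (sq d h x) y ↔
    (∃ h', mv d m U h h' ∧ y = sq d h' x) ∨
      (base (!d) h ∧ ∃ x', mv d m U x x' ∧ y = sq d h x') := by
  cases d <;> constructor
  · rintro (_ | _ | _)
    exacts [.inl ⟨_, ‹_›, rfl⟩, .inr ⟨‹_›, _, ‹_›, rfl⟩]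
  · rintro (⟨_, h1, rfl⟩ | ⟨h1, _, h2, rfl⟩)
    exacts [.seqR _ h1, .seqL h1 h2]
  · rintro (_ | _ | _)
    exacts [.inl ⟨_, ‹_›, rfl⟩, .inr ⟨‹_›, _, ‹_›, rfl⟩]
  · rintro (⟨_, h1, rfl⟩ | ⟨h1, _, h2, rfl⟩)
    exacts [.seqL _ h1, .seqR h1 h2]

/-- Reversing the direction swaps the factors: in direction `!d` it is `x` that comes before `h`. -/
theorem mv_not_sq {h x y : Term V A} : mv (!d) m U (sq d h x) y ↔
    (∃ x', mv (!d) m U x x' ∧ y = sq d h x') ∨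
      (base d x ∧ ∃ h', mv (!d) m U h h' ∧ y = sq d h' x) := by
  have := mv_sq (d := !d) (m := m) (U := U) (h := x) (x := h) (y := y)
  cases d <;> exact this

theorem mv_abs {I : Set A} {x y : Term V A} : mv d m U (.abs I x) y ↔
    ∃ W x', mv d m W x x' ∧ U = W.map (hide I) ∧ y = .abs I x' := by
  cases d <;> constructor
  · rintro ⟨⟩; exact ⟨_, _, ‹_›, rfl, rfl⟩
  · rintro ⟨W, x', h, rfl, rfl⟩; exact .abs I h
  · rintro ⟨⟩; exact ⟨_, _, ‹_›, rfl, rfl⟩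
  · rintro ⟨W, x', h, rfl, rfl⟩; exact .abs I h

theorem fin_sq {e : Bool} {h x : Term V A} : fin e (sq d h x) ↔ fin e h ∧ fin e x := by
  cases d <;> cases e <;> constructor
  all_goals first
    | (rintro ⟨⟩; exact ⟨‹_›, ‹_›⟩)
    | (rintro ⟨h1, h2⟩; first | exact .seq h1 h2 | exact .seq h2 h1)

theorem fin_abs {I : Set A} {x : Term V A} : fin d (.abs I x) ↔ fin d x := by
  cases d <;> constructor
  · rintro ⟨⟩; assumption
  · exact .abs I
  · rintro ⟨⟩; assumption
  · exact .abs I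

theorem base_sq {e : Bool} {h x : Term V A} : base e (sq d h x) ↔ base e h ∧ base e x := by
  cases d <;> cases e <;> first | exact Iff.rfl | exact and_comm

theorem base_abs {I : Set A} {x : Term V A} : base d (.abs I x) ↔ base d x := by
  cases d <;> exact Iff.rfl

theorem inert_sq {e : Bool} {h x : Term V A} : Inert e (sq d h x) ↔ Inert e h ∧ Inert e x := by
  cases d <;> first | exact Iff.rfl | exact and_comm

theorem inert_abs {I : Set A} {x : Term V A} : Inert d (.abs I x) ↔ Inert d x := by
  cases d <;> exact Iff.rfl

theorem base.inert {x : Term V A} (h : base d x) : Inert (!d) x := by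
  induction x <;> cases d <;> simp_all [base, Inert, Std, NStd]

theorem step_term_inert (d : Bool) (k : ℕ) (s : Step A) : Inert (!d) (todo d s k : Term V A) := by
  induction s with
  | ev e => cases d <;> rfl
  | par s t hs ht => cases d <;> exact ⟨hs, ht⟩

theorem inert_frec_rhs (E : FSpec V A) (X : V) : Inert false (E.rhs X) := by
  simp only [FSpec.rhs, inert_sum, List.mem_map]
  rintro _ ⟨s, -, rfl⟩
  unfold FSpec.term
  cases s.next with
  | none => exact step_term_inert true 0 _
  | some Y => exact ⟨step_term_inert true 0 _, rfl⟩

theorem inert_rrec_rhs (E : RSpec V A) (X : V) : Inert true (E.rhs X) := by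
  simp only [RSpec.rhs, inert_sum, List.mem_map]
  rintro _ ⟨s, -, rfl⟩
  unfold RSpec.term
  cases s.next with
  | none => exact step_term_inert false _ _
  | some Y => exact ⟨rfl, step_term_inert false _ _⟩

/-- Constants are handled by unfolding: the right-hand side of a forward equation contains nothing
to undo, and that of a reverse one nothing to execute. Hence `Inert` may treat a constant as an
atom. -/
theorem mv.not_inert {x y : Term V A} (h : mv d m U x y) : ¬ Inert d x := by
  cases d
  · induction h with
    | past | altL | altR | seqR | seqL | par | abs => simp_all [Inert]
    | frec E X _ ih => exact fun _ => ih (inert_frec_rhs E X)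
    | rrec => simp [Inert]
  · induction h with
    | act | altL | altR | seqR | seqL | par | abs => simp_all [Inert]
    | rrec E X _ ih => exact fun _ => ih (inert_rrec_rhs E X)
    | frec => simp [Inert]

theorem fin.not_inert {x : Term V A} (h : fin d x) : ¬ Inert (!d) x := by
  cases d
  · induction h with
    | act | altL | altR | seq | par | abs => simp_all [Inert]
    | rrec E X _ ih => exact fun _ => ih (inert_rrec_rhs E X)
    | frec => simp [Inert]
  · induction h with
    | past | altL | altR | seq | par | abs => simp_all [Inert]
    | frec E X _ ih => exact fun _ => ih (inert_frec_rhs E X)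
    | rrec => simp [Inert]

theorem base.not_mv {x y : Term V A} (h : base d x) : ¬ mv (!d) m U x y :=
  fun h' => h'.not_inert h.inert

theorem base.not_fin {x : Term V A} (h : base d x) : ¬ fin d x :=
  fun h' => h'.not_inert h.inert

theorem base_not.not_mv {x y : Term V A} (h : base (!d) x) : ¬ mv d m U x y := by
  simpa using h.not_mv (m := m) (U := U) (y := y)

theorem todo_base (d : Bool) (s : Step A) (k : ℕ) : base d (todo d s k : Term V A) := by
  induction s with
  | ev e => cases d <;> trivial
  | par s t hs ht => cases d <;> exact ⟨hs, ht⟩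

theorem todo_fin (d : Bool) (s : Step A) (k : ℕ) : fin (!d) (todo d s k : Term V A) := by
  induction s with
  | ev e => cases d <;> constructor
  | par s t hs ht => cases d <;> exact .par hs ht

theorem mv_todo (d : Bool) (s : Step A) (k : ℕ) :
    ∃ m, mv d m s.events (todo d s k : Term V A) (todo (!d) s k) := by
  -- Undoing forces the key `k`; for execution any key would do.
  refine ⟨k, ?_⟩
  induction s with
  | ev e => cases d <;> constructor
  | par s t hs ht => cases d <;> exact .par hs ht

theorem mv.todo_inv {s : Step A} {k : ℕ} {y : Term V A} (h : mv d m U (todo d s k) y) :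
    U = s.events ∧ y = todo (!d) s m := by
  induction s generalizing U y with
  | ev e => cases d <;> cases h <;> exact ⟨rfl, rfl⟩
  | par s t hs ht =>
    cases d
    all_goals
      cases h with
      | par h1 h2 =>
        obtain ⟨rfl, rfl⟩ := hs h1
        obtain ⟨rfl, rfl⟩ := ht h2
        exact ⟨rfl, rfl⟩

end Basic

/-! ### Internal steps and prefixes built from them -/

section Hiding

theorem vis_eq_zero {U : Multiset (Ev A)} : vis U = 0 ↔ ∀ a, some a ∉ U := by
  rw [Multiset.eq_zero_iff_forall_notMem]
  simp [vis, Multiset.mem_filterMap]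

theorem Internal.vis_hide {I : Set A} {U : Multiset (Ev A)} (h : Internal I U) :
    vis (U.map (hide I)) = 0 := by
  rw [vis_eq_zero]
  intro a ha
  obtain ⟨e, he, hea⟩ := Multiset.mem_map.1 ha
  cases e with
  | none => simp [hide] at hea
  | some b => simp [hide, h b he] at hea

theorem Internal.vis {U : Multiset (Ev A)} (h : Internal ∅ U) : vis U = 0 :=
  vis_eq_zero.2 fun a ha => h a ha

end Hiding

/-- Transitions with all events in `I ∪ {τ}`. -/
abbrev IPath (d : Bool) (I : Set A) : Term V A → Term V A → Prop :=
  Relation.ReflTransGen fun x y => ∃ m U, mv d m U x y ∧ Internal I U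

/-- Silent transitions. -/
abbrev TauPath (d : Bool) : Term V A → Term V A → Prop :=
  Relation.ReflTransGen fun x y => ∃ m U, mv d m U x y ∧ vis U = 0

/-- A single step with events in `I ∪ {τ}`, still to be done in direction `d`. -/
def Todo (d : Bool) (I : Set A) (h : Term V A) : Prop :=
  ∃ s k, Internal I s.events ∧ h = todo d s k

/-- A single step with events in `I ∪ {τ}`, done or not. -/
def Item (d : Bool) (I : Set A) (h : Term V A) : Prop := Todo d I h ∨ Todo (!d) I h

section Items

variable {d : Bool} {I : Set A} {m : ℕ} {U : Multiset (Ev A)} {h h' : Term V A}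

theorem Todo.base (hh : Todo d I h) : base d h := by
  obtain ⟨s, k, -, rfl⟩ := hh
  exact todo_base d s k

theorem Todo.fin (hh : Todo d I h) : fin (!d) h := by
  obtain ⟨s, k, -, rfl⟩ := hh
  exact todo_fin d s k

theorem Todo.fin_not (hh : Todo (!d) I h) : FRAlgebra.fin d h := by
  simpa using hh.fin

theorem Todo.mv_exists (hh : Todo d I h) :
    ∃ m U h', mv d m U h h' ∧ Internal I U ∧ Todo (!d) I h' := by
  obtain ⟨s, k, hs, rfl⟩ := hh
  obtain ⟨m, hm⟩ := mv_todo (V := V) d s k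
  exact ⟨m, _, _, hm, hs, s, k, hs, rfl⟩

theorem Todo.mv_inv (hh : Todo d I h) (hm : mv d m U h h') : Internal I U ∧ Todo (!d) I h' := by
  obtain ⟨s, k, hs, rfl⟩ := hh
  obtain ⟨rfl, rfl⟩ := hm.todo_inv
  exact ⟨hs, s, m, hs, rfl⟩

theorem Todo.not_mv_inv (hh : Todo (!d) I h) (hm : mv (!d) m U h h') :
    Internal I U ∧ Todo d I h' := by
  simpa using hh.mv_inv hm

theorem Item.not (hh : Item d I h) : Item (!d) I h := by
  rcases hh with hh | hh
  · exact .inr (by simpa using hh)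
  · exact .inl hh

theorem Item.mv_inv (hh : Item d I h) (hm : mv d m U h h') : Internal I U ∧ Item d I h' := by
  rcases hh with hh | hh
  · exact (hh.mv_inv hm).imp_right .inr
  · exact absurd hm (base_not.not_mv hh.base)

theorem Item.not_mv_inv (hh : Item d I h) (hm : mv (!d) m U h h') :
    Internal I U ∧ Item d I h' := by
  have := hh.not.mv_inv hm
  exact ⟨this.1, by simpa using this.2.not⟩

/-- A step still to be done could move in direction `d`, which `base (!d)` excludes. -/
theorem Item.of_base_not (hh : Item d I h) (hb : FRAlgebra.base (!d) h) : Todo (!d) I h := by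
  refine hh.resolve_left fun ht => ?_
  obtain ⟨m, U, h', h1, -⟩ := ht.mv_exists
  exact base_not.not_mv hb h1

end Items

/-- `Pre d J x u`: the term `u` is `x`, preceded by terms in `J`. -/
inductive Pre (d : Bool) (J : Term V A → Prop) (x : Term V A) : Term V A → Prop
  | nil : Pre d J x x
  | cons {h t} : J h → Pre d J x t → Pre d J x (sq d h t)

section Prefix

variable {d : Bool} {I : Set A} {m : ℕ} {U : Multiset (Ev A)} {J J' : Term V A → Prop}
  {x x' u u' : Term V A}

theorem Pre.mono (hJ : ∀ h, J h → J' h) (hu : Pre d J x u) : Pre d J' x u := by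
  induction hu with
  | nil => exact .nil
  | cons hh _ ih => exact .cons (hJ _ hh) ih

theorem Pre.trans (h1 : Pre d J x x') (h2 : Pre d J x' u) : Pre d J x u := by
  induction h2 with
  | nil => exact h1
  | cons hh _ ih => exact .cons hh ih

theorem Pre.done_item (hu : Pre d (Todo (!d) I) x u) : Pre d (Item d I) x u :=
  hu.mono fun _ => .inr

theorem Pre.todo_item (hu : Pre d (Todo d I) x u) : Pre d (Item d I) x u :=
  hu.mono fun _ => .inl

theorem Pre.base_iff {e : Bool} (hJ : ∀ h, J h → base e h) (hu : Pre d J x u) :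
    base e u ↔ base e x := by
  induction hu with
  | nil => rfl
  | cons hh _ ih => rw [base_sq, ih, and_iff_right (hJ _ hh)]

theorem Pre.base_of {e : Bool} (hu : Pre d J x u) (hb : base e u) : base e x := by
  induction hu with
  | nil => exact hb
  | cons _ _ ih => exact ih (base_sq.1 hb).2

theorem Pre.fin_of {e : Bool} (hu : Pre d J x u) (hf : fin e u) : fin e x := by
  induction hu with
  | nil => exact hf
  | cons _ _ ih => exact ih (fin_sq.1 hf).2

theorem Pre.fin {e : Bool} (hJ : ∀ h, J h → fin e h) (hu : Pre d J x u)
    (hf : FRAlgebra.fin e x) : FRAlgebra.fin e u := by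
  induction hu with
  | nil => exact hf
  | cons hh _ ih => exact fin_sq.2 ⟨hJ _ hh, ih⟩

theorem Pre.mv_of (hJ : ∀ h, J h → base (!d) h) (hu : Pre d J x u) (hm : mv d m U x x') :
    ∃ u', mv d m U u u' ∧ Pre d J x' u' := by
  induction hu with
  | nil => exact ⟨x', hm, .nil⟩
  | cons hh _ ih =>
    obtain ⟨t', h1, h2⟩ := ih
    exact ⟨_, mv_sq.2 (.inr ⟨hJ _ hh, t', h1, rfl⟩), .cons hh h2⟩

theorem Pre.mv_not_of (hu : Pre d J x u) (hm : mv (!d) m U x x') :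
    ∃ u', mv (!d) m U u u' ∧ Pre d J x' u' := by
  induction hu with
  | nil => exact ⟨x', hm, .nil⟩
  | cons hh _ ih =>
    obtain ⟨t', h1, h2⟩ := ih
    exact ⟨_, mv_not_sq.2 (.inl ⟨t', h1, rfl⟩), .cons hh h2⟩

theorem Pre.mv_inv (hJ : ∀ h, J h → base (!d) h) (hu : Pre d J x u) (hm : mv d m U u u') :
    ∃ x', mv d m U x x' ∧ Pre d J x' u' := by
  induction hu generalizing u' with
  | nil => exact ⟨u', hm, .nil⟩
  | cons hh _ ih =>
    rcases mv_sq.1 hm with ⟨h', h1, rfl⟩ | ⟨-, t', h1, rfl⟩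
    · exact absurd h1 (base_not.not_mv (hJ _ hh))
    · obtain ⟨x', h2, h3⟩ := ih h1
      exact ⟨x', h2, .cons hh h3⟩

/-- The core can move only when every factor before it is completed, so a move of the core certifies
that the whole prefix is done. -/
theorem Pre.item_mv_inv (hu : Pre d (Item d I) x u) (hm : mv d m U u u') :
    (Internal I U ∧ Pre d (Item d I) x u') ∨
      ∃ x', mv d m U x x' ∧ Pre d (Todo (!d) I) x' u' := by
  induction hu generalizing u' with
  | nil => exact .inr ⟨u', hm, .nil⟩
  | cons hh ht ih =>
    rcases mv_sq.1 hm with ⟨h', h1, rfl⟩ | ⟨hb, t', h1, rfl⟩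
    · obtain ⟨h2, h3⟩ := hh.mv_inv h1
      exact .inl ⟨h2, .cons h3 ht⟩
    · rcases ih h1 with ⟨h2, h3⟩ | ⟨x', h3, h4⟩
      · exact .inl ⟨h2, .cons hh h3⟩
      · exact .inr ⟨x', h3, .cons (hh.of_base_not hb) h4⟩

/-- A factor of the prefix can be undone only if all that follows it is back in its initial form,
and this includes the core. -/
theorem Pre.done_mv_not_inv (hu : Pre d (Todo (!d) I) x u) (hm : mv (!d) m U u u') :
    (base d x ∧ Internal I U ∧ Pre d (Item d I) x u') ∨
      ∃ x', mv (!d) m U x x' ∧ Pre d (Todo (!d) I) x' u' := by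
  induction hu generalizing u' with
  | nil => exact .inr ⟨u', hm, .nil⟩
  | cons hh ht ih =>
    rcases mv_not_sq.1 hm with ⟨t', h1, rfl⟩ | ⟨hb, h', h1, rfl⟩
    · rcases ih h1 with ⟨h0, h2, h3⟩ | ⟨x', h3, h4⟩
      · exact .inl ⟨h0, h2, .cons (.inr hh) h3⟩
      · exact .inr ⟨x', h3, .cons hh h4⟩
    · obtain ⟨h2, h3⟩ := hh.not_mv_inv h1
      exact .inl ⟨ht.base_of hb, h2, .cons (.inl h3) ht.done_item⟩

theorem Pre.item_mv_not_inv (hx : Inert (!d) x) (hu : Pre d (Item d I) x u)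
    (hm : mv (!d) m U u u') : Internal I U ∧ Pre d (Item d I) x u' := by
  induction hu generalizing u' with
  | nil => exact absurd hx hm.not_inert
  | cons hh ht ih =>
    rcases mv_not_sq.1 hm with ⟨t', h1, rfl⟩ | ⟨-, h', h1, rfl⟩
    · exact (ih h1).imp_right (.cons hh)
    · exact (hh.not_mv_inv h1).imp_right fun h2 => .cons h2 ht

theorem IPath.sq_left {I : Set A} {h h' : Term V A} (hp : IPath d I h h') (x : Term V A) :
    IPath d I (sq d h x) (sq d h' x) :=
  hp.lift (fun y => sq d y x) fun _ _ ⟨m, U, h1, h2⟩ => ⟨m, U, mv_sq.2 (.inl ⟨_, h1, rfl⟩), h2⟩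

theorem IPath.sq_right {I : Set A} {h : Term V A} (hh : base (!d) h) (hp : IPath d I x x') :
    IPath d I (sq d h x) (sq d h x') :=
  hp.lift (fun y => sq d h y) fun _ _ ⟨m, U, h1, h2⟩ =>
    ⟨m, U, mv_sq.2 (.inr ⟨hh, _, h1, rfl⟩), h2⟩

theorem IPath.not_sq_right {I : Set A} (h : Term V A) (hp : IPath (!d) I x x') :
    IPath (!d) I (sq d h x) (sq d h x') :=
  hp.lift (fun y => sq d h y) fun _ _ ⟨m, U, h1, h2⟩ =>
    ⟨m, U, mv_not_sq.2 (.inl ⟨_, h1, rfl⟩), h2⟩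

theorem Item.path_done {h : Term V A} (hh : Item d I h) :
    ∃ h', IPath d I h h' ∧ Todo (!d) I h' := by
  rcases hh with hh | hh
  · obtain ⟨m, U, h', h1, h2, h3⟩ := hh.mv_exists
    exact ⟨h', .single ⟨m, U, h1, h2⟩, h3⟩
  · exact ⟨h, .refl, hh⟩

theorem Item.path_todo {h : Term V A} (hh : Item d I h) :
    ∃ h', IPath (!d) I h h' ∧ Todo d I h' := by
  simpa using hh.not.path_done

/-- Factors are completed from the outside inwards, as each one unlocks the next. -/
theorem Pre.path_done (hu : Pre d (Item d I) x u) :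
    ∃ u', IPath d I u u' ∧ Pre d (Todo (!d) I) x u' := by
  induction hu with
  | nil => exact ⟨x, .refl, .nil⟩
  | cons hh _ ih =>
    obtain ⟨t', h1, h2⟩ := ih
    obtain ⟨h', h3, h4⟩ := hh.path_done
    exact ⟨_, (IPath.sq_left h3 _).trans (IPath.sq_right h4.base h1), .cons h4 h2⟩

theorem Pre.path_todo (hx : base d x) (hu : Pre d (Item d I) x u) :
    ∃ u', IPath (!d) I u u' ∧ Pre d (Todo d I) x u' := by
  induction hu with
  | nil => exact ⟨x, .refl, .nil⟩
  | cons hh _ ih =>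
    obtain ⟨t', h1, h2⟩ := ih
    obtain ⟨h', h3, h4⟩ := hh.path_todo
    have hb : base d t' := (h2.base_iff fun _ => Todo.base).2 hx
    -- Undoing proceeds from the inside outwards; `hb` is what then unlocks the outer factor.
    refine ⟨_, (IPath.not_sq_right _ h1).trans (h3.lift (fun y => sq d y t') ?_), .cons h4 h2⟩
    exact fun _ _ ⟨m, U, h5, h6⟩ => ⟨m, U, mv_not_sq.2 (.inr ⟨hb, _, h5, rfl⟩), h6⟩

theorem Pre.path_of (hJ : ∀ h, J h → base (!d) h) (hu : Pre d J x u) (hp : IPath d I x x') :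
    ∃ u', IPath d I u u' ∧ Pre d J x' u' := by
  induction hp with
  | refl => exact ⟨u, .refl, hu⟩
  | tail _ hm ih =>
    obtain ⟨m, U, hm, hI⟩ := hm
    obtain ⟨u₁, h1, h2⟩ := ih
    obtain ⟨u₂, h3, h4⟩ := h2.mv_of hJ hm
    exact ⟨u₂, h1.tail ⟨m, U, h3, hI⟩, h4⟩

end Prefix

/-! ### States of the two sides of the rule -/

/-- The states `o · τ_I(u)` where `o` is a silent step and `u` is `x` preceded by internal steps,
all of them being in `J`. -/
def Full (d : Bool) (I : Set A) (J : Set A → Term V A → Prop) (x p : Term V A) : Prop :=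
  ∃ o u, J ∅ o ∧ Pre d (J I) x u ∧ p = sq d o (.abs I u)

section Full

variable {d : Bool} {I : Set A} {m : ℕ} {U W : Multiset (Ev A)} {x x' u p p' : Term V A}

theorem IPath.abs (h : IPath d I u x) : TauPath d (.abs I u) (.abs I x) :=
  h.lift (Term.abs I) fun _ _ ⟨m, _, h1, h2⟩ => ⟨m, _, mv_abs.2 ⟨_, _, h1, rfl, rfl⟩, h2.vis_hide⟩

theorem IPath.tau (h : IPath d ∅ u x) : TauPath d u x :=
  h.lift id fun _ _ ⟨m, U, h1, h2⟩ => ⟨m, U, h1, h2.vis⟩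

theorem TauPath.sq_right {o : Term V A} (ho : base (!d) o) (h : TauPath d u x) :
    TauPath d (sq d o u) (sq d o x) :=
  h.lift (sq d o) fun _ _ ⟨m, U, h1, h2⟩ => ⟨m, U, mv_sq.2 (.inr ⟨ho, _, h1, rfl⟩), h2⟩

theorem TauPath.not_sq_right (o : Term V A) (h : TauPath (!d) u x) :
    TauPath (!d) (sq d o u) (sq d o x) :=
  h.lift (sq d o) fun _ _ ⟨m, U, h1, h2⟩ => ⟨m, U, mv_not_sq.2 (.inl ⟨_, h1, rfl⟩), h2⟩

theorem TauPath.not_sq_left {o o' : Term V A} (hx : base d x) (h : TauPath (!d) o o') :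
    TauPath (!d) (sq d o x) (sq d o' x) :=
  h.lift (fun y => sq d y x) fun _ _ ⟨m, U, h1, h2⟩ =>
    ⟨m, U, mv_not_sq.2 (.inr ⟨hx, _, h1, rfl⟩), h2⟩

theorem Full.done_item (h : Full d I (Todo !d) x p) : Full d I (Item d) x p := by
  obtain ⟨o, u, ho, hu, rfl⟩ := h
  exact ⟨o, u, .inr ho, hu.done_item, rfl⟩

theorem Full.todo_item (h : Full d I (Todo d) x p) : Full d I (Item d) x p := by
  obtain ⟨o, u, ho, hu, rfl⟩ := h
  exact ⟨o, u, .inl ho, hu.todo_item, rfl⟩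

theorem Full.trans_pre (h : Full d I (Todo !d) u p) (hu : Pre d (Todo (!d) I) x u) :
    Full d I (Todo !d) x p := by
  obtain ⟨o, u', ho, hu', rfl⟩ := h
  exact ⟨o, u', ho, hu.trans hu', rfl⟩

theorem Full.item_mv_inv (h : Full d I (Item d) x p) (hm : mv d m U p p') :
    (vis U = 0 ∧ Full d I (Item d) x p') ∨ ∃ x' W, mv d m W x x' ∧ U = W.map (hide I) ∧
      Full d I (Todo !d) x' p' := by
  obtain ⟨o, u, ho, hu, rfl⟩ := h
  rcases mv_sq.1 hm with ⟨o', h1, rfl⟩ | ⟨hb, y, h1, rfl⟩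
  · obtain ⟨h2, h3⟩ := ho.mv_inv h1
    exact .inl ⟨h2.vis, o', u, h3, hu, rfl⟩
  · obtain ⟨W, u', h2, rfl, rfl⟩ := mv_abs.1 h1
    have hd := ho.of_base_not hb
    rcases hu.item_mv_inv h2 with ⟨h3, h4⟩ | ⟨x', h4, h5⟩
    · exact .inl ⟨h3.vis_hide, o, u', ho, h4, rfl⟩
    · exact .inr ⟨x', W, h4, rfl, o, u', hd, h5, rfl⟩

/-- With nothing left to do in the prefix, every move in direction `d` comes from the core. -/
theorem Full.done_mv_inv (h : Full d I (Todo !d) x p) (hm : mv d m U p p') :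
    ∃ x' W, mv d m W x x' ∧ U = W.map (hide I) ∧ Full d I (Todo !d) x' p' := by
  obtain ⟨o, u, ho, hu, rfl⟩ := h
  rcases mv_sq.1 hm with ⟨o', h1, rfl⟩ | ⟨-, y, h1, rfl⟩
  · exact absurd h1 (base_not.not_mv ho.base)
  · obtain ⟨W, u', h2, rfl, rfl⟩ := mv_abs.1 h1
    obtain ⟨x', h3, h4⟩ := hu.mv_inv (fun _ => Todo.base) h2
    exact ⟨x', W, h3, rfl, o, u', ho, h4, rfl⟩

theorem Full.done_mv_not_inv (h : Full d I (Todo !d) x p) (hm : mv (!d) m U p p') :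
    (base d x ∧ vis U = 0 ∧ Full d I (Item d) x p') ∨ ∃ x' W, mv (!d) m W x x' ∧
      U = W.map (hide I) ∧ Full d I (Todo !d) x' p' := by
  obtain ⟨o, u, ho, hu, rfl⟩ := h
  rcases mv_not_sq.1 hm with ⟨y, h1, rfl⟩ | ⟨hb, o', h1, rfl⟩
  · obtain ⟨W, u', h2, rfl, rfl⟩ := mv_abs.1 h1
    rcases hu.done_mv_not_inv h2 with ⟨h0, h3, h4⟩ | ⟨x', h4, h5⟩
    · exact .inl ⟨h0, h3.vis_hide, o, u', .inr ho, h4, rfl⟩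
    · exact .inr ⟨x', W, h4, rfl, o, u', ho, h5, rfl⟩
  · obtain ⟨h2, h3⟩ := ho.not_mv_inv h1
    exact .inl ⟨hu.base_of (base_abs.1 hb), h2.vis, o', u, .inl h3, hu.done_item, rfl⟩

/-- An inert core contributes no move, and undoing the prefix is invisible: `o` is silent itself,
and the other steps are hidden by `τ_I`. -/
theorem Full.item_mv_not_inv (hx : Inert (!d) x) (h : Full d I (Item d) x p)
    (hm : mv (!d) m U p p') : vis U = 0 ∧ Full d I (Item d) x p' := by
  obtain ⟨o, u, ho, hu, rfl⟩ := h
  rcases mv_not_sq.1 hm with ⟨y, h1, rfl⟩ | ⟨hb, o', h1, rfl⟩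
  · obtain ⟨W, u', h2, rfl, rfl⟩ := mv_abs.1 h1
    obtain ⟨h3, h4⟩ := hu.item_mv_not_inv hx h2
    exact ⟨h3.vis_hide, o, u', ho, h4, rfl⟩
  · obtain ⟨h2, h3⟩ := ho.not_mv_inv h1
    exact ⟨h2.vis, o', u, h3, hu, rfl⟩

theorem Full.mv_of (h : Full d I (Todo !d) x p) (hm : mv d m W x x') :
    ∃ p', mv d m (W.map (hide I)) p p' ∧ Full d I (Todo !d) x' p' := by
  obtain ⟨o, u, ho, hu, rfl⟩ := h
  obtain ⟨u', h1, h2⟩ := hu.mv_of (fun _ => Todo.base) hm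
  exact ⟨_, mv_sq.2 (.inr ⟨ho.base, _, mv_abs.2 ⟨W, u', h1, rfl, rfl⟩, rfl⟩),
    o, u', ho, h2, rfl⟩

theorem Full.mv_not_of (h : Full d I (Todo !d) x p) (hm : mv (!d) m W x x') :
    ∃ p', mv (!d) m (W.map (hide I)) p p' ∧ Full d I (Todo !d) x' p' := by
  obtain ⟨o, u, ho, hu, rfl⟩ := h
  obtain ⟨u', h1, h2⟩ := hu.mv_not_of hm
  exact ⟨_, mv_not_sq.2 (.inl ⟨_, mv_abs.2 ⟨W, u', h1, rfl, rfl⟩, rfl⟩), o, u', ho, h2, rfl⟩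

theorem Full.path_of (h : Full d I (Todo !d) x p) (hx : IPath d I x x') :
    ∃ p', TauPath d p p' ∧ Full d I (Todo !d) x' p' := by
  obtain ⟨o, u, ho, hu, rfl⟩ := h
  obtain ⟨u', h1, h2⟩ := hu.path_of (fun _ => Todo.base) hx
  exact ⟨_, h1.abs.sq_right ho.base, o, u', ho, h2, rfl⟩

theorem Full.path_done (h : Full d I (Item d) x p) :
    ∃ p', TauPath d p p' ∧ Full d I (Todo !d) x p' := by
  obtain ⟨o, u, ho, hu, rfl⟩ := h
  obtain ⟨u', h1, h2⟩ := hu.path_done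
  obtain ⟨o', h3, h4⟩ := ho.path_done
  exact ⟨_, (h3.sq_left (.abs I u)).tau.trans (h1.abs.sq_right h4.base), o', u', h4, h2, rfl⟩

theorem Full.path_todo (hx : base d x) (h : Full d I (Item d) x p) :
    ∃ p', TauPath (!d) p p' ∧ Full d I (Todo d) x p' := by
  obtain ⟨o, u, ho, hu, rfl⟩ := h
  obtain ⟨u', h1, h2⟩ := hu.path_todo hx
  obtain ⟨o', h3, h4⟩ := ho.path_todo
  have hb : base d u' := (h2.base_iff fun _ => Todo.base).2 hx
  exact ⟨_, (h1.abs.not_sq_right o).trans (h3.tau.not_sq_left (base_abs.2 hb)),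
    o', u', h4, h2, rfl⟩

theorem Full.fin_of {J : Set A → Term V A → Prop} {e : Bool} (h : Full d I J x p)
    (hf : fin e p) : fin e x := by
  obtain ⟨o, u, -, hu, rfl⟩ := h
  exact hu.fin_of (fin_abs.1 (fin_sq.1 hf).2)

theorem Full.done_fin (h : Full d I (Todo !d) x p) (hf : fin d x) : fin d p := by
  obtain ⟨o, u, ho, hu, rfl⟩ := h
  exact fin_sq.2 ⟨ho.fin_not, fin_abs.2 (hu.fin (fun _ => Todo.fin_not) hf)⟩

theorem Full.todo_fin (h : Full d I (Todo d) x p) (hf : fin (!d) x) : fin (!d) p := by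
  obtain ⟨o, u, ho, hu, rfl⟩ := h
  exact fin_sq.2 ⟨ho.fin, fin_abs.2 (hu.fin (fun _ => Todo.fin) hf)⟩

theorem Full.done_not_fin (h : Full d I (Todo !d) x p) : ¬ fin (!d) p := by
  obtain ⟨o, u, ho, hu, rfl⟩ := h
  exact fun hf => ho.base.not_fin (fin_sq.1 hf).1

theorem Full.todo_not_fin (h : Full d I (Todo d) x p) : ¬ fin d p := by
  obtain ⟨o, u, ho, hu, rfl⟩ := h
  exact fun hf => ho.base.not_fin (fin_sq.1 hf).1

/-- `x` behind internal steps, which are all done if `x` does not allow to undo them. -/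
def Good (d : Bool) (I : Set A) (x p : Term V A) : Prop :=
  Full d I (Todo !d) x p ∨ (base d x ∧ Full d I (Item d) x p)

theorem Good.item (h : Good d I x p) : Full d I (Item d) x p :=
  h.elim Full.done_item And.right

end Full

/-! ### Transfer conditions common to both directions -/

section KeyedMatching

/-- The transfer conditions of `StepTransfer` for the transitions in direction `e`, with the keys
kept. -/
def KeyedTransfer (e : Bool) (R : Term V A → Term V A → Prop) (p q : Term V A) : Prop :=
  (∀ m U p', mv e m U p p' → (vis U = 0 ∧ R p' q) ∨
    ∃ q₀ q' W, TauPath e q q₀ ∧ R p q₀ ∧ mv e m W q₀ q' ∧ vis W = vis U ∧ R p' q') ∧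
  (fin e p → ∃ q₀, TauPath e q q₀ ∧ R p q₀ ∧ fin e q₀)

/-- The transfer conditions of `RootStep` for the transitions in direction `e`, with the keys
kept. -/
def KeyedRoot (e : Bool) (R : Term V A → Term V A → Prop) (p q : Term V A) : Prop :=
  (∀ m U p', mv e m U p p' → ∃ W q', mv e m W q q' ∧ vis W = vis U ∧ R p' q') ∧
  (fin e p → fin e q)

variable {R : Term V A → Term V A → Prop}

theorem TauPath.rstep {x y : Term V A} (h : TauPath false x y) : TauStar rstep x y :=
  h.lift id fun _ _ ⟨m, U, h1, h2⟩ => ⟨m, U, h1, by rw [h2, Multiset.map_zero]⟩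

theorem Matches.of_keyed (hs : ∀ p q, R p q → R q p)
    (h : ∀ p q, R p q → ∀ e, KeyedTransfer e R p q) : Matches R := by
  refine ⟨hs, fun p q hpq => ?_, fun p q hpq => ?_⟩
  · refine ⟨?_, (h p q hpq true).2⟩
    rintro _ p' ⟨m, U, hU, rfl⟩
    rcases (h p q hpq true).1 m U p' hU with h1 | ⟨q₀, q', W, h1, h2, h3, h4, h5⟩
    · exact .inl h1
    · exact .inr ⟨q₀, q', h1, h2, ⟨m, W, h3, h4⟩, h5⟩
  · refine ⟨?_, fun hp => ?_⟩
    · rintro _ p' ⟨m, U, hU, rfl⟩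
      rcases (h p q hpq false).1 m U p' hU with ⟨h1, h2⟩ | ⟨q₀, q', W, h1, h2, h3, h4, h5⟩
      · exact .inl ⟨by rw [h1, Multiset.map_zero], h2⟩
      · exact .inr ⟨q₀, q', h1.rstep, h2, ⟨m, W, h3, by rw [h4]⟩, h5⟩
    · obtain ⟨q₀, h1, h2, h3⟩ := (h p q hpq false).2 hp
      exact ⟨q₀, h1.rstep, h2, h3⟩

theorem RootMatches.of_keyed {p q : Term V A} (h : ∀ e, KeyedRoot e R p q) :
    RootMatches R p q := by
  refine ⟨⟨?_, (h true).2⟩, ⟨?_, (h false).2⟩⟩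
  · rintro _ p' ⟨m, U, hU, rfl⟩
    obtain ⟨W, q', h1, h2, h3⟩ := (h true).1 m U p' hU
    exact ⟨q', ⟨m, W, h1, h2⟩, h3⟩
  · rintro _ p' ⟨m, U, hU, rfl⟩
    obtain ⟨W, q', h1, h2, h3⟩ := (h false).1 m U p' hU
    exact ⟨q', ⟨m, W, h1, by rw [h2]⟩, h3⟩

end KeyedMatching

/-! ### Linear systems -/

/-- `X` has a finite path to a summand without a variable. -/
inductive Ends {σ : Type v} (eqn : V → List (Summand σ V)) : V → Prop
  | last {X s} : s ∈ eqn X → s.next = none → Ends eqn X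
  | next {X s Z} : s ∈ eqn X → s.next = some Z → Ends eqn Z → Ends eqn X

/-- A summand of a linear equation, as a term. -/
def linTerm {σ : Type v} (d : Bool) (step : σ → Step A) (key : σ → ℕ) (rc : V → Term V A)
    (s : Summand σ V) : Term V A :=
  match s.next with
  | some Y => sq d (todo d (step s.act) (key s.act)) (rc Y)
  | none => todo d (step s.act) (key s.act)

/-- What forward (`d = true`) and reverse (`d = false`) linear specifications have in common. -/
structure LinearSystem (d : Bool) (σ : Type v) (V : Type u) (A : Type v) where
  eqn : V → List (Summand σ V)
  step : σ → Step A
  key : σ → ℕ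
  rc : V → Term V A
  rc_injective : Function.Injective rc
  rc_ne_sq : ∀ X h t, rc X ≠ sq d h t
  base_rc : ∀ X, base d (rc X)
  not_base_rc : ∀ X, ¬ base (!d) (rc X)
  mv_rc : ∀ e m U X y, mv e m U (rc X) y ↔ ∃ s ∈ eqn X, mv e m U (linTerm d step key rc s) y
  fin_rc : ∀ e X, fin e (rc X) ↔ ∃ s ∈ eqn X, fin e (linTerm d step key rc s)
  ends_of_fin : ∀ X, fin (!d) (rc X) → Ends eqn X

namespace LinearSystem

variable {d : Bool} {σ : Type v} (S : LinearSystem d σ V A) {I : Set A} {m : ℕ}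
  {U : Multiset (Ev A)}

/-- A summand as a term. -/
abbrev term (s : Summand σ V) : Term V A := linTerm d S.step S.key S.rc s

theorem term_none {s : Summand σ V} (h : s.next = none) :
    S.term s = todo d (S.step s.act) (S.key s.act) := by
  simp only [term, linTerm, h]

theorem term_some {s : Summand σ V} {Z : V} (h : s.next = some Z) :
    S.term s = sq d (todo d (S.step s.act) (S.key s.act)) (S.rc Z) := by
  simp only [term, linTerm, h]

theorem base_term (s : Summand σ V) : base d (S.term s) := by
  cases h : s.next with
  | none => rw [S.term_none h]; exact todo_base _ _ _
  | some Z => rw [S.term_some h, base_sq]; exact ⟨todo_base _ _ _, S.base_rc Z⟩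

theorem mv_term_none {s : Summand σ V} (h : s.next = none) {y : Term V A}
    (hm : mv d m U (S.term s) y) : base (!d) y := by
  rw [S.term_none h] at hm
  rw [hm.todo_inv.2]
  exact todo_base _ _ _

theorem mv_term_some {s : Summand σ V} {Z : V} (h : s.next = some Z) {y : Term V A}
    (hm : mv d m U (S.term s) y) : U = (S.step s.act).events ∧
      y = sq d (todo (!d) (S.step s.act) m) (S.rc Z) := by
  rw [S.term_some h] at hm
  rcases mv_sq.1 hm with ⟨h', h1, rfl⟩ | ⟨hb, t, h1, rfl⟩
  · obtain ⟨rfl, rfl⟩ := h1.todo_inv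
    exact ⟨rfl, rfl⟩
  -- The variable is still blocked, because the step before it can move and so is not completed.
  · obtain ⟨k, hk⟩ := mv_todo (V := V) d (S.step s.act) (S.key s.act)
    exact absurd hk (base_not.not_mv hb)

theorem fin_of_ends {X : V} (h : Ends S.eqn X) : fin (!d) (S.rc X) := by
  induction h with
  | @last X s hs hn =>
    refine (S.fin_rc _ _).2 ⟨s, hs, ?_⟩
    change fin (!d) (S.term s)
    rw [S.term_none hn]
    exact todo_fin _ _ _
  | @next X s Z hs hn _ ih =>
    refine (S.fin_rc _ _).2 ⟨s, hs, ?_⟩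
    change fin (!d) (S.term s)
    rw [S.term_some hn]
    exact fin_sq.2 ⟨todo_fin _ _ _, ih⟩

/-- Stripping factors on the same side must end at the same constant, since a constant is never a
sequential composition. This reconciles the arbitrary history allowed in the definition of clusters
with the internal steps actually performed. -/
theorem pre_rc_unique {J J' : Term V A → Prop} {Y Z : V} {t : Term V A}
    (h1 : Pre d J (S.rc Y) t) (h2 : Pre d J' (S.rc Z) t) : Y = Z := by
  have key : ∀ {h t h' t' : Term V A}, sq d h t = sq d h' t' → t = t' := by
    intro h t h' t' e
    cases d <;> (cases e; rfl)
  induction h1 with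
  | nil =>
    generalize hx : S.rc Y = x at h2
    cases h2 with
    | nil => exact S.rc_injective hx
    | cons _ _ => exact absurd hx (S.rc_ne_sq _ _ _)
  | @cons h t _ _ ih =>
    generalize hx : sq d h t = x at h2
    cases h2 with
    | nil => exact absurd hx.symm (S.rc_ne_sq _ _ _)
    | cons _ h4 => exact ih (key hx ▸ h4)

/-- Internal transitions lead from `X` to `Y`, up to what is done on the way. -/
def Reach (I : Set A) (X Y : V) : Prop :=
  ∃ t, IPath d I (S.rc X) t ∧ Pre d (base !d) (S.rc Y) t

/-- By linearity, each move from a variable leaves one completed step before the next variable, or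
finishes the process. `Ends` passes backwards along the summands used. -/
theorem reach_cases {Y : V} {t : Term V A} (h : IPath d I (S.rc Y) t) :
    (∃ W, Pre d (Todo (!d) I) (S.rc W) t ∧ (Ends S.eqn W → Ends S.eqn Y)) ∨ base (!d) t := by
  induction h with
  | refl => exact .inl ⟨Y, .nil, id⟩
  | tail _ hm ih =>
    obtain ⟨m, U, hm, hI⟩ := hm
    rcases ih with ⟨W, hW, hE⟩ | hb
    · obtain ⟨x', h1, h2⟩ := hW.mv_inv (fun _ => Todo.base) hm
      obtain ⟨s, hs, h3⟩ := (S.mv_rc _ _ _ _ _).1 h1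
      cases hn : s.next with
      | none => exact .inr ((h2.base_iff fun _ => Todo.base).2 (S.mv_term_none hn h3))
      | some Z =>
        obtain ⟨rfl, rfl⟩ := S.mv_term_some hn h3
        exact .inl ⟨Z, .trans (.cons ⟨_, _, hI, rfl⟩ .nil) h2, fun hZ => hE (.next hs hn hZ)⟩
    · exact absurd hm (base_not.not_mv hb)

theorem Reach.exists_done {S : LinearSystem d σ V A} {Y Z : V} (h : S.Reach I Y Z) :
    ∃ t, IPath d I (S.rc Y) t ∧ Pre d (Todo (!d) I) (S.rc Z) t ∧
      (Ends S.eqn Z → Ends S.eqn Y) := by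
  obtain ⟨t, h1, h2⟩ := h
  rcases S.reach_cases h1 with ⟨W, hW, hE⟩ | hb
  · obtain rfl := S.pre_rc_unique hW h2
    exact ⟨t, h1, hW, hE⟩
  · exact absurd (h2.base_of hb) (S.not_base_rc Z)

/-! ### Clusters and the bisimulation behind the rule -/

/-- `C` is the cluster of a variable `X` for `I`, with the given exits. -/
structure IsCluster (I : Set A) (X : V) (C : V → Prop) (exits : List (Summand σ V)) : Prop where
  self : C X
  reach : ∀ Y, C Y → S.Reach I X Y ∧ S.Reach I Y X
  mem_exits : ∀ s, s ∈ exits ↔ (∃ Y, C Y ∧ s ∈ S.eqn Y) ∧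
    ∀ Z, s.next = some Z → ¬ Internal I (S.step s.act).events ∨ ¬ C Z

/-- The term on the right-hand side of the cluster fair abstraction rule. -/
abbrev exitSum (exits : List (Summand σ V)) : Term V A := .sum (exits.map S.term)

/-- The terms from which exactly the exits of the cluster can be reached by internal steps. -/
def Tail (C : V → Prop) (exits : List (Summand σ V)) (x : Term V A) : Prop :=
  (∃ Y, C Y ∧ x = S.rc Y) ∨ x = S.exitSum exits

/-- The terms related by the cluster fair abstraction rule. -/
def CfarRel (I : Set A) (C : V → Prop) (exits : List (Summand σ V)) (p q : Term V A) : Prop :=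
  (∃ x, Good d I x p ∧ Good d I x q) ∨
    ∃ x y, S.Tail C exits x ∧ S.Tail C exits y ∧ Full d I (Item d) x p ∧ Full d I (Item d) y q

variable {S} {X : V} {C : V → Prop} {exits : List (Summand σ V)} {x x' y p q : Term V A}

theorem CfarRel.symm (h : S.CfarRel I C exits p q) : S.CfarRel I C exits q p := by
  rcases h with ⟨x, h1, h2⟩ | ⟨x, y, h1, h2, h3, h4⟩
  · exact .inl ⟨x, h2, h1⟩
  · exact .inr ⟨y, x, h2, h1, h4, h3⟩

theorem mv_exitSum {e : Bool} :
    mv e m U (S.exitSum exits) x ↔ ∃ s ∈ exits, mv e m U (S.term s) x := by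
  simp [exitSum, mv_sum]

theorem fin_exitSum {e : Bool} : fin e (S.exitSum exits) ↔ ∃ s ∈ exits, fin e (S.term s) := by
  simp [exitSum, fin_sum]

theorem Tail.inert (h : S.Tail C exits x) : Inert (!d) x := by
  rcases h with ⟨Y, -, rfl⟩ | rfl
  · exact (S.base_rc Y).inert
  · rw [exitSum, inert_sum]
    simp only [List.mem_map]
    rintro _ ⟨s, -, rfl⟩
    exact (S.base_term s).inert

theorem Tail.not_fin (h : S.Tail C exits x) : ¬ fin d x :=
  fun hf => hf.not_inert h.inert

theorem IsCluster.exists_done (hC : S.IsCluster I X C exits) {Y Z : V} (hY : C Y) (hZ : C Z) :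
    ∃ t, IPath d I (S.rc Y) t ∧ Pre d (Todo (!d) I) (S.rc Z) t ∧
      (Ends S.eqn Z → Ends S.eqn Y) := by
  obtain ⟨t₁, h1, h2, h3⟩ := (hC.reach Y hY).2.exists_done
  obtain ⟨t₂, h4, h5, h6⟩ := (hC.reach Z hZ).1.exists_done
  -- The route from `Y` to `Z` goes through `X`; its second half is replayed behind the steps
  -- completed in the first.
  obtain ⟨t, h7, h8⟩ := h2.path_of (fun _ => Todo.base) h4
  exact ⟨t, h1.trans h7, h5.trans h8, h3 ∘ h6⟩

theorem IsCluster.exit_or_internal (hC : S.IsCluster I X C exits) {Y : V} (hY : C Y)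
    {s : Summand σ V} (hs : s ∈ S.eqn Y) :
    s ∈ exits ∨ ∃ Z, s.next = some Z ∧ Internal I (S.step s.act).events ∧ C Z := by
  by_cases h : s ∈ exits
  · exact .inl h
  · rw [hC.mem_exits, not_and] at h
    have := h ⟨Y, hY, hs⟩
    push Not at this
    exact .inr this

theorem IsCluster.tail_mv (hC : S.IsCluster I X C exits) (hx : S.Tail C exits x)
    (hm : mv d m U x x') :
    (Internal I U ∧ ∃ y, S.Tail C exits y ∧ Pre d (Todo (!d) I) y x') ∨
      ∃ s ∈ exits, mv d m U (S.term s) x' := by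
  rcases hx with ⟨Y, hY, rfl⟩ | rfl
  · obtain ⟨s, hs, h1⟩ := (S.mv_rc _ _ _ _ _).1 hm
    rcases hC.exit_or_internal hY hs with he | ⟨Z, hn, hI, hZ⟩
    · exact .inr ⟨s, he, h1⟩
    · obtain ⟨rfl, rfl⟩ := S.mv_term_some hn h1
      exact .inl ⟨hI, S.rc Z, .inl ⟨Z, hZ, rfl⟩, .cons ⟨_, _, hI, rfl⟩ .nil⟩
  · exact .inr (mv_exitSum.1 hm)

/-- Mutual reachability inside the cluster makes every exit available from every variable by
internal moves; the sum of exits offers it at once. -/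
theorem IsCluster.tail_path (hC : S.IsCluster I X C exits) (hx : S.Tail C exits x)
    {s : Summand σ V} (hs : s ∈ exits) (hm : mv d m U (S.term s) x') :
    ∃ u y, IPath d I x u ∧ S.Tail C exits y ∧ Pre d (Todo (!d) I) y u ∧ mv d m U y x' := by
  rcases hx with ⟨Y, hY, rfl⟩ | rfl
  · obtain ⟨⟨Z, hZ, hsZ⟩, -⟩ := (hC.mem_exits s).1 hs
    obtain ⟨t, h1, h2, -⟩ := hC.exists_done hY hZ
    exact ⟨t, _, h1, .inl ⟨Z, hZ, rfl⟩, h2, (S.mv_rc _ _ _ _ _).2 ⟨s, hsZ, hm⟩⟩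
  · exact ⟨_, _, .refl, .inr rfl, .nil, mv_exitSum.2 ⟨s, hs, hm⟩⟩

/-- Follow a chain of summands that ends without a variable. Its last summand is an exit, so there
is a first exit on the chain, and what follows that exit still ends. -/
theorem IsCluster.exit_of_ends (hC : S.IsCluster I X C exits) {Y : V} (hY : C Y)
    (h : Ends S.eqn Y) : ∃ s ∈ exits, fin (!d) (S.term s) := by
  induction h with
  | @last Y s hs hn =>
    rcases hC.exit_or_internal hY hs with he | ⟨Z, hn', -⟩
    · refine ⟨s, he, ?_⟩
      rw [S.term_none hn]
      exact todo_fin _ _ _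
    · rw [hn] at hn'
      cases hn'
  | @next Y s Z hs hn hZ ih =>
    rcases hC.exit_or_internal hY hs with he | ⟨Z', hn', -, hZ'⟩
    · refine ⟨s, he, ?_⟩
      rw [S.term_some hn]
      exact fin_sq.2 ⟨todo_fin _ _ _, S.fin_of_ends hZ⟩
    · rw [hn] at hn'
      cases hn'
      exact ih hZ'

theorem IsCluster.tail_fin (hC : S.IsCluster I X C exits) (hx : S.Tail C exits x)
    (hy : S.Tail C exits y) (hf : fin (!d) x) : base d y ∧ fin (!d) y := by
  have hs : ∃ s ∈ exits, fin (!d) (S.term s) := by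
    rcases hx with ⟨Y, hY, rfl⟩ | rfl
    · exact hC.exit_of_ends hY (S.ends_of_fin Y hf)
    · exact fin_exitSum.1 hf
  obtain ⟨s, hs, hfs⟩ := hs
  rcases hy with ⟨Y, hY, rfl⟩ | rfl
  · obtain ⟨⟨Z, hZ, hsZ⟩, -⟩ := (hC.mem_exits s).1 hs
    obtain ⟨-, -, -, hE⟩ := hC.exists_done hY hZ
    exact ⟨S.base_rc Y, S.fin_of_ends (hE (S.ends_of_fin Z ((S.fin_rc _ _).2 ⟨s, hsZ, hfs⟩)))⟩
  -- The exit `s` shows that the sum is not empty; this matters because `δ` is neither `Std` nor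
  -- `NStd` and would block undoing the prefix.
  · refine ⟨base_sum ?_ ?_, fin_exitSum.2 ⟨s, hs, hfs⟩⟩
    · simpa using List.ne_nil_of_mem hs
    · simp only [List.mem_map]
      rintro _ ⟨s, -, rfl⟩
      exact S.base_term s

/-- The answering side silently completes its prefix, after which the common core can copy any move.
-/
theorem good_keyedTransfer (hp : Good d I x p) (hq : Good d I x q) :
    KeyedTransfer d (S.CfarRel I C exits) p q := by
  obtain ⟨q₀, hq₀, hd⟩ := hq.item.path_done
  refine ⟨fun m U p' hm => ?_, fun hf => ⟨q₀, hq₀, .inl ⟨x, hp, .inl hd⟩,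
    hd.done_fin (hp.item.fin_of hf)⟩⟩
  have key : (base d x ∧ vis U = 0 ∧ Full d I (Item d) x p') ∨
      ∃ x' W, mv d m W x x' ∧ U = W.map (hide I) ∧ Full d I (Todo !d) x' p' := by
    rcases hp with hp | ⟨hb, hp⟩
    · exact .inr (hp.done_mv_inv hm)
    · exact (hp.item_mv_inv hm).imp_left (⟨hb, ·⟩)
  rcases key with ⟨hb, h0, h1⟩ | ⟨x', W, h2, rfl, h3⟩
  · exact .inl ⟨h0, .inl ⟨x, .inr ⟨hb, h1⟩, hq⟩⟩
  · obtain ⟨q', h4, h5⟩ := hd.mv_of h2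
    exact .inr ⟨q₀, q', _, hq₀, .inl ⟨x, hp, .inl hd⟩, h4, rfl, .inl ⟨x', .inl h3, .inl h5⟩⟩

theorem good_keyedTransfer_not (hp : Good d I x p) (hq : Good d I x q) :
    KeyedTransfer (!d) (S.CfarRel I C exits) p q := by
  refine ⟨fun m U p' hm => ?_, fun hf => ?_⟩
  · rcases hp with hp | ⟨hb, hp⟩
    · rcases hp.done_mv_not_inv hm with ⟨hb, h1, h2⟩ | ⟨x', W, h1, rfl, h2⟩
      · exact .inl ⟨h1, .inl ⟨x, .inr ⟨hb, h2⟩, hq⟩⟩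
      -- The core has something to undo, so `Good` forces the prefix of `q` to be completed, and no
      -- silent step is needed before the answer.
      · have hq' : Full d I (Todo !d) x q := hq.resolve_right fun h => h.1.not_mv h1
        obtain ⟨q', h3, h4⟩ := hq'.mv_not_of h1
        exact .inr ⟨q, q', _, .refl, .inl ⟨x, .inl hp, hq⟩, h3, rfl,
          .inl ⟨x', .inl h2, .inl h4⟩⟩
    · obtain ⟨h1, h2⟩ := hp.item_mv_not_inv hb.inert hm
      exact .inl ⟨h1, .inl ⟨x, .inr ⟨hb, h2⟩, hq⟩⟩
  · rcases hp with hp | ⟨hb, hp⟩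
    · exact absurd hf hp.done_not_fin
    · obtain ⟨q₀, h1, h2⟩ := hq.item.path_todo hb
      exact ⟨q₀, h1, .inl ⟨x, .inr ⟨hb, hp⟩, .inr ⟨hb, h2.todo_item⟩⟩,
        h2.todo_fin (hp.fin_of hf)⟩

theorem IsCluster.keyedTransfer (hC : S.IsCluster I X C exits) (hx : S.Tail C exits x)
    (hy : S.Tail C exits y) (hp : Full d I (Item d) x p) (hq : Full d I (Item d) y q) :
    KeyedTransfer d (S.CfarRel I C exits) p q := by
  refine ⟨fun m U p' hm => ?_, fun hf => absurd (hp.fin_of hf) hx.not_fin⟩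
  rcases hp.item_mv_inv hm with ⟨h0, h1⟩ | ⟨x', W, h2, rfl, h3⟩
  · exact .inl ⟨h0, .inr ⟨x, y, hx, hy, h1, hq⟩⟩
  · rcases hC.tail_mv hx h2 with ⟨hI, z, hz, h4⟩ | ⟨s, hs, h4⟩
    -- A move within the cluster is absorbed: the step just done joins the prefix, and the new core
    -- is again a cluster variable.
    · exact .inl ⟨hI.vis_hide, .inr ⟨z, y, hz, hy, (h3.trans_pre h4).done_item, hq⟩⟩
    -- For an exit, the other side completes its prefix and walks to a core offering that exit. The
    -- exit leads to the very same term, so the pair becomes one with a common core.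
    · obtain ⟨u, z, h5, hz, h6, h7⟩ := hC.tail_path hy hs h4
      obtain ⟨q₁, h8, h9⟩ := hq.path_done
      obtain ⟨q₂, h10, h11⟩ := h9.path_of h5
      have h12 := h11.trans_pre h6
      obtain ⟨q', h13, h14⟩ := h12.mv_of h7
      exact .inr ⟨q₂, q', _, h8.trans h10, .inr ⟨x, z, hx, hz, hp, h12.done_item⟩, h13, rfl,
        .inl ⟨x', .inl h3, .inl h14⟩⟩

theorem IsCluster.keyedTransfer_not (hC : S.IsCluster I X C exits) (hx : S.Tail C exits x)
    (hy : S.Tail C exits y) (hp : Full d I (Item d) x p) (hq : Full d I (Item d) y q) :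
    KeyedTransfer (!d) (S.CfarRel I C exits) p q := by
  refine ⟨fun m U p' hm => ?_, fun hf => ?_⟩
  · obtain ⟨h1, h2⟩ := hp.item_mv_not_inv hx.inert hm
    exact .inl ⟨h1, .inr ⟨x, y, hx, hy, h2, hq⟩⟩
  · obtain ⟨hb, hfy⟩ := hC.tail_fin hx hy (hp.fin_of hf)
    obtain ⟨q₀, h1, h2⟩ := hq.path_todo hb
    exact ⟨q₀, h1, .inr ⟨x, y, hx, hy, hp, h2.todo_item⟩, h2.todo_fin hfy⟩

theorem IsCluster.matches (hC : S.IsCluster I X C exits) : Matches (S.CfarRel I C exits) := by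
  refine .of_keyed (fun _ _ => CfarRel.symm) fun p q hpq e => ?_
  rcases Bool.eq_or_eq_not e d with rfl | rfl
  · rcases hpq with ⟨x, h1, h2⟩ | ⟨x, y, h1, h2, h3, h4⟩
    · exact good_keyedTransfer h1 h2
    · exact hC.keyedTransfer h1 h2 h3 h4
  · rcases hpq with ⟨x, h1, h2⟩ | ⟨x, y, h1, h2, h3, h4⟩
    · exact good_keyedTransfer_not h1 h2
    · exact hC.keyedTransfer_not h1 h2 h3 h4

/-- The guarding silent step makes the rule rooted: it is the only possible first move in direction
`d`, both sides do it alike, and nothing can move in direction `!d`. -/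
theorem IsCluster.rootMatches (hC : S.IsCluster I X C exits) (hx : S.Tail C exits x)
    (hy : S.Tail C exits y) (k : ℕ) :
    RootMatches (S.CfarRel I C exits) (sq d (todo d (.ev none) k) (.abs I x))
      (sq d (todo d (.ev none) k) (.abs I y)) := by
  have ho : Todo d ∅ (todo d (.ev none) k : Term V A) :=
    ⟨.ev none, k, fun a ha => by simp [Step.events] at ha, rfl⟩
  have full : ∀ z, Full d I (Todo d) z (sq d (todo d (.ev none) k) (.abs I z)) :=
    fun z => ⟨_, z, ho, .nil, rfl⟩
  refine .of_keyed fun e => ?_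
  rcases Bool.eq_or_eq_not e d with rfl | rfl
  · refine ⟨fun m U p' hm => ?_, fun hf => absurd hf (full x).todo_not_fin⟩
    rcases mv_sq.1 hm with ⟨o', h1, rfl⟩ | ⟨hb, -⟩
    · have h2 := (ho.mv_inv h1).2
      exact ⟨U, _, mv_sq.2 (.inl ⟨o', h1, rfl⟩), rfl, .inr ⟨x, y, hx, hy,
        ⟨o', x, .inr h2, .nil, rfl⟩, ⟨o', y, .inr h2, .nil, rfl⟩⟩⟩
    · obtain ⟨m, U, h', h1, -⟩ := ho.mv_exists
      exact absurd h1 (base_not.not_mv hb)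
  · refine ⟨fun m U p' hm => ?_, fun hf => ?_⟩
    · exact absurd (inert_sq.2 ⟨ho.base.inert, inert_abs.2 hx.inert⟩) hm.not_inert
    · exact (full y).todo_fin (hC.tail_fin hx hy ((full x).fin_of hf)).2

theorem IsCluster.cfar (hC : S.IsCluster I X C exits) (k : ℕ) {p q : Term V A}
    (hp : p = sq d (todo d (.ev none) k) (.abs I (S.rc X)))
    (hq : q = sq d (todo d (.ev none) k) (.abs I (S.exitSum exits))) :
    RbsFR p q ∧ RbpFR p q ∧ RbhpFR p q := by
  subst hp hq
  have hX : S.Tail C exits (S.rc X) := .inl ⟨X, hC.self, rfl⟩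
  have hE : S.Tail C exits (S.exitSum exits) := .inr rfl
  exact hC.matches.rooted (hC.rootMatches hX hE k) (hC.rootMatches hE hX k)

end LinearSystem

/-! ### Termination through recursion, and the two kinds of specification -/

/-- Terms from which everything can be undone, where the parts are to be done in direction `d`. -/
def Undoable : Bool → Term V A → Prop
  | d, .act _ => d = true
  | d, .past _ _ => d = false
  | _, .delta => False
  | d, .alt x y => Undoable d x ∨ Undoable d y
  | d, .seq x y => Undoable d x ∧ Undoable d y
  | d, .par x y => Undoable d x ∧ Undoable d y
  | d, .abs _ x => Undoable d x
  | d, .frec E X => d = true ∧ Ends E X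
  | d, .rrec E X => d = false ∧ Ends E X

theorem undoable_sum {d : Bool} {l : List (Term V A)} :
    Undoable d (.sum l) ↔ ∃ x ∈ l, Undoable d x := by
  induction l with
  | nil => simp [Term.sum, Undoable]
  | cons x l ih =>
    cases l with
    | nil => simp [Term.sum]
    | cons x' l => rw [List.exists_mem_cons_iff, ← ih, Term.sum, Undoable]

theorem FSpec.ends_of_undoable_rhs {E : FSpec V A} {X : V} (h : Undoable true (E.rhs X)) :
    Ends E X := by
  simp only [FSpec.rhs, undoable_sum, List.mem_map] at h
  obtain ⟨_, ⟨s, hs, rfl⟩, h⟩ := h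
  unfold FSpec.term at h
  cases hn : s.next with
  | none => exact .last hs hn
  | some Y =>
    rw [hn] at h
    exact .next hs hn h.2.2

theorem RSpec.ends_of_undoable_rhs {E : RSpec V A} {X : V} (h : Undoable false (E.rhs X)) :
    Ends E X := by
  simp only [RSpec.rhs, undoable_sum, List.mem_map] at h
  obtain ⟨_, ⟨s, hs, rfl⟩, h⟩ := h
  unfold RSpec.term at h
  cases hn : s.next with
  | none => exact .last hs hn
  | some Y =>
    rw [hn] at h
    exact .next hs hn h.1.2

/-- A termination derivation is finite, so each unfolding of a constant inside it must reach a
summand without a variable. Stating this for all terms is what lets the induction pass through the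
right-hand sides. -/
theorem fin.undoable {d : Bool} {x : Term V A} (h : fin (!d) x) : Undoable d x := by
  cases d
  · induction h with
    | past | altL | altR | seq | par | abs => simp_all [Undoable]
    | frec E X h => exact absurd (inert_frec_rhs E X) (fin.not_inert (d := true) h)
    | rrec E X _ ih => exact ⟨rfl, RSpec.ends_of_undoable_rhs ih⟩
  · induction h with
    | act | altL | altR | seq | par | abs => simp_all [Undoable]
    | rrec E X h => exact absurd (inert_rrec_rhs E X) (fin.not_inert (d := false) h)
    | frec E X _ ih => exact ⟨rfl, FSpec.ends_of_undoable_rhs ih⟩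

theorem FSpec.term_eq (E : FSpec V A) :
    FSpec.term E = linTerm true id (fun _ => 0) (Term.frec E) := by
  funext s
  unfold FSpec.term linTerm
  cases s.next <;> rfl

theorem RSpec.term_eq (E : RSpec V A) :
    RSpec.term E = linTerm false Prod.fst Prod.snd (Term.rrec E) := by
  funext s
  unfold RSpec.term linTerm
  cases s.next <;> rfl

/-- A forward linear specification as a linear system. -/
def FSpec.system (E : FSpec V A) : LinearSystem true (Step A) V A where
  eqn := E
  step := id
  key _ := 0
  rc := .frec E
  rc_injective X Y h := by cases h; rfl
  rc_ne_sq X h t := nofun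
  base_rc X := trivial
  not_base_rc X h := h
  mv_rc e m U X y := by
    have : mv e m U (.frec E X) y ↔ mv e m U (E.rhs X) y := by
      cases e <;> exact ⟨fun h => by cases h; assumption, .frec E X⟩
    rw [this, FSpec.rhs, mv_sum, ← FSpec.term_eq]
    simp
  fin_rc e X := by
    have : fin e (.frec E X) ↔ fin e (E.rhs X) := by
      cases e <;> exact ⟨fun h => by cases h; assumption, .frec E X⟩
    rw [this, FSpec.rhs, fin_sum, ← FSpec.term_eq]
    simp
  ends_of_fin X h := h.undoable.2

/-- A reverse linear specification as a linear system. -/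
def RSpec.system (E : RSpec V A) : LinearSystem false (Step A × ℕ) V A where
  eqn := E
  step := Prod.fst
  key := Prod.snd
  rc := .rrec E
  rc_injective X Y h := by cases h; rfl
  rc_ne_sq X h t := nofun
  base_rc X := trivial
  not_base_rc X h := h
  mv_rc e m U X y := by
    have : mv e m U (.rrec E X) y ↔ mv e m U (E.rhs X) y := by
      cases e <;> exact ⟨fun h => by cases h; assumption, .rrec E X⟩
    rw [this, RSpec.rhs, mv_sum, ← RSpec.term_eq]
    simp
  fin_rc e X := by
    have : fin e (.rrec E X) ↔ fin e (E.rhs X) := by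
      cases e <;> exact ⟨fun h => by cases h; assumption, .rrec E X⟩
    rw [this, RSpec.rhs, fin_sum, ← RSpec.term_eq]
    simp
  ends_of_fin X h := h.undoable.2

theorem FSpec.Reaches.reach {E : FSpec V A} {I : Set A} {X Y : V} (h : E.Reaches I X Y) :
    E.system.Reach I X Y := by
  obtain ⟨t, h1, h2⟩ := h
  refine ⟨t, h1, ?_⟩
  clear h1
  induction h2 with
  | here => exact .nil
  | after hh _ ih => exact .cons (d := true) hh ih

theorem RSpec.Reaches.reach {E : RSpec V A} {I : Set A} {X Y : V} (h : E.Reaches I X Y) :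
    E.system.Reach I X Y := by
  obtain ⟨t, h1, h2⟩ := h
  refine ⟨t, h1, ?_⟩
  clear h1
  induction h2 with
  | here => exact .nil
  | before hh _ ih => exact .cons (d := false) hh ih

theorem FSpec.isCluster {E : FSpec V A} {I : Set A} {X : V} {exits : List (Summand (Step A) V)}
    (h : ∀ s, s ∈ exits ↔ E.IsExit I X s) :
    E.system.IsCluster I X (E.SameCluster I X) exits where
  self := ⟨⟨_, .refl, .here⟩, ⟨_, .refl, .here⟩⟩
  reach _ hY := ⟨hY.1.reach, hY.2.reach⟩
  mem_exits := h

theorem RSpec.isCluster {E : RSpec V A} {I : Set A} {X : V}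
    {exits : List (Summand (Step A × ℕ) V)} (h : ∀ s, s ∈ exits ↔ E.IsExit I X s) :
    E.system.IsCluster I X (E.SameCluster I X) exits where
  self := ⟨⟨_, .refl, .here⟩, ⟨_, .refl, .here⟩⟩
  reach _ hY := ⟨hY.1.reach, hY.2.reach⟩
  mem_exits := h

end FRAlgebra

theorem mainTheorem11 {V : Type*} [Finite V] {A : Type*} :
    (∀ (E : FRAlgebra.FSpec V A) (I : Set A) (X : V)
        (exits : List (FRAlgebra.Summand (FRAlgebra.Step A) V)),
      FRAlgebra.FSpec.Guarded E →
      (∀ s, s ∈ exits ↔ FRAlgebra.FSpec.IsExit E I X s) →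
      let lhs : FRAlgebra.Term V A := .seq (.act none) (.abs I (.frec E X))
      let rhs : FRAlgebra.Term V A :=
        .seq (.act none) (.abs I (.sum (exits.map (FRAlgebra.FSpec.term E))))
      FRAlgebra.RbsFR lhs rhs ∧ FRAlgebra.RbpFR lhs rhs ∧ FRAlgebra.RbhpFR lhs rhs) ∧
    (∀ (E : FRAlgebra.RSpec V A) (I : Set A) (X : V) (k : ℕ)
        (exits : List (FRAlgebra.Summand (FRAlgebra.Step A × ℕ) V)),
      FRAlgebra.RSpec.Guarded E →
      (∀ s, s ∈ exits ↔ FRAlgebra.RSpec.IsExit E I X s) →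
      let lhs : FRAlgebra.Term V A := .seq (.abs I (.rrec E X)) (.past none k)
      let rhs : FRAlgebra.Term V A :=
        .seq (.abs I (.sum (exits.map (FRAlgebra.RSpec.term E)))) (.past none k)
      FRAlgebra.RbsFR lhs rhs ∧ FRAlgebra.RbpFR lhs rhs ∧ FRAlgebra.RbhpFR lhs rhs) := by
  refine ⟨fun E I X exits _ h => ?_, fun E I X k exits _ h => ?_⟩
  -- The key `0` is a dummy for the unexecuted `τ`; in the reverse case the executed `τ` carries the
  -- key `k`.
  · exact (FRAlgebra.FSpec.isCluster h).cfar 0 rfl (by rw [FRAlgebra.FSpec.term_eq]; rfl)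
  · exact (FRAlgebra.RSpec.isCluster h).cfar k rfl (by rw [FRAlgebra.RSpec.term_eq]; rfl)
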